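/- Fix $T>0$, $\sigma^2>0$ and $0<\lambda^2<2$. Let $W$ be a Gaussian white noise of variance $dt\,dh$ on the upper half-plane $\{(t,h):h>0\}$, and for $\ell\ge 0$ let $C_{\ell,T}(t)=\{(t',h):h>\ell,\ |t'-t|<\tfrac12\min(h,T)\}$. For $0<H<\tfrac12$ let $\nu_H$ be such that $\lambda^2=H(1-2H)\nu_H^2$, and let $\omega_{H,T}$ be the S-fBM process: a version with continuous paths of $$\omega_{H,T}(t)=m_H+\int_{C_{0,T}(t)}dG_H,\qquad dG_H=\sqrt{H(1-2H)\nu_H^2}\;h^{H-1}\,dW ,$$ so that $dG_H$ has variance $\lambda^2h^{2H-2}\,dh\,dt$. It is the stationary Gaussian process with mean $m_H$ and covariance $\tfrac{\nu_H^2}{2}(T^{2H}-|\tau|^{2H})$ if $|\tau|<T$ and $0$ if $|\tau|\ge T$. The mean level is fixed, $\sigma^2=e^{m_H+\mathrm{Var}(\omega_{H,T}(0))/2}$, i.e. $\mathbb E[e^{\omega_{H,T}(t)}]=\sigma^2$. Let $M_{H,T}(dt)=e^{\omega_{H,T}(t)}dt$ be the log S-fBM measure. For $\ell>0$ let $\omega_{\ell,T}$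 be a version with continuous paths of $\mu_\ell+\int_{C_{\ell,T}(t)}dG_0$ with $dG_0=\lambda h^{-1}\,dW$, where $\mu_\ell$ is such that $\mathbb E[e^{\omega_{\ell,T}(t)}]=\sigma^2$, and let $\widetilde M_{\ell,T}(dt)=e^{\omega_{\ell,T}(t)}dt$. Then, as $H\to0$, $\nu_H^2\to+\infty$ and $m_H\to-\infty$, and there is a random locally finite measure $\widetilde M_T$ on $\mathbb R$ such that: 1. $\widetilde M_{\ell,T}\to\widetilde M_T$ weakly as $\ell\to0$, i.e. $\widetilde M_T$ is the log-normal multifractal random measure with intermittency $\lambda^2$, integral scale $T$ and mean level $\sigma^2$; 2. $M_{H,T}\to\widetilde M_T$ weakly as $H\to0$; 3. if moreover $\lambda^2<1$, then $\mathbb E\big[(M_{H,T}[0,t]-\widetilde M_T[0,t])^2\big]\to0$ as $H\to0$, for every $t\ge0$. Weak convergence of random measures means weak convergence of their laws on the space of locally finite Borel measures on $\mathbb R$ with the vague topology. -/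

import Mathlib

open MeasureTheory ProbabilityTheory Filter Topology
open scoped CompactlySupported

noncomputable section

namespace LogSfBM

/-! ### Locally finite measures on the line, with the vague topology -/

/-- The locally finite Borel measures on the real line. -/
def LocFinMeasure : Type := {μ : Measure ℝ // IsLocallyFiniteMeasure μ}

/-- The vague topology: the coarsest one for which `μ ↦ ∫ f dμ` is continuous for every continuous
compactly supported `f`. -/
instance : TopologicalSpace LocFinMeasure :=
  ⨅ f : C_c(ℝ, ℝ), TopologicalSpace.induced (fun μ : LocFinMeasure => ∫ x, f x ∂μ.1) inferInstance

instance : MeasurableSpace LocFinMeasure := borel LocFinMeasure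

instance : BorelSpace LocFinMeasure := ⟨rfl⟩

/-- The measure `e^{g(t)} dt`, for a continuous path `g`. -/
def expMeasure (g : C(ℝ, ℝ)) : LocFinMeasure :=
  ⟨volume.withDensity fun t => ENNReal.ofReal (Real.exp (g t)),
    IsLocallyFiniteMeasure.withDensity_ofReal (Real.continuous_exp.comp g.continuous)⟩

/-! ### White noise on the upper half-plane -/

/-- Lebesgue measure `dt dh` on the open upper half-plane `{(t, h) : h > 0}`. -/
def halfPlane : Measure (ℝ × ℝ) := volume.restrict {p | 0 < p.2}

/-- `W` is a Gaussian white noise with variance `dt dh` on the upper half-plane; `W f` is the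
Wiener integral `∫ f dW` of a square-integrable deterministic function `f`. -/
structure IsWhiteNoise {Ω : Type*} [MeasurableSpace Ω] (W : (ℝ × ℝ → ℝ) → Ω → ℝ)
    (P : Measure Ω) : Prop where
  hasLaw : ∀ f, MemLp f 2 halfPlane →
    HasLaw (W f) (gaussianReal 0 (∫ p, f p ^ 2 ∂halfPlane).toNNReal) P
  linear : ∀ (a b : ℝ) (f g : ℝ × ℝ → ℝ), MemLp f 2 halfPlane → MemLp g 2 halfPlane →
    W (a • f + b • g) =ᵐ[P] a • W f + b • W g

/-! ### The log-volatility processes -/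

/-- The domain `C_{ℓ,T}(t) = {(t', h) : h > ℓ, |t' - t| < min(h, T) / 2}`. -/
def cone (ℓ T t : ℝ) : Set (ℝ × ℝ) := {p | ℓ < p.2 ∧ |p.1 - t| < min p.2 T / 2}

/-- The integrand such that `∫_{C_{ℓ,T}(t)} dG_H = W (coneKernel c H ℓ T t)`, where
`dG_H = √c h^{H-1} dW` is the Gaussian noise of variance `c h^{2H-2} dh dt`. -/
def coneKernel (c H ℓ T t : ℝ) : ℝ × ℝ → ℝ :=
  (cone ℓ T t).indicator fun p => √c * p.2 ^ (H - 1)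

/-- `X` is a version with continuous paths of the process `t ↦ m + ∫_{C_{ℓ,T}(t)} dG_H`, where
`dG_H` is the Gaussian noise of variance `c h^{2H-2} dh dt` obtained from the white noise `W`. -/
def IsConeProcess {Ω : Type*} [MeasurableSpace Ω] (W : (ℝ × ℝ → ℝ) → Ω → ℝ) (P : Measure Ω)
    (c H ℓ T m : ℝ) (X : Ω → C(ℝ, ℝ)) : Prop :=
  ∀ t, ∀ᵐ a ∂P, X a t = m + W (coneKernel c H ℓ T t) a

/-- The S-fBM process `ω_{H,T}` with mean `m` and variance parameter `ν²`, i.e. the continuous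
stationary Gaussian process with mean `m` and covariance `(ν²/2) (T^{2H} - |τ|^{2H})` for
`|τ| < T` and `0` for `|τ| ≥ T`. It is driven by the noise of variance `H(1-2H)ν² h^{2H-2} dh dt`
over the full domains `C_{0,T}(t)`. -/
def IsSfBM {Ω : Type*} [MeasurableSpace Ω] (W : (ℝ × ℝ → ℝ) → Ω → ℝ) (P : Measure Ω)
    (H T m nu : ℝ) (X : Ω → C(ℝ, ℝ)) : Prop :=
  IsConeProcess W P (H * (1 - 2 * H) * nu ^ 2) H 0 T m X

/-- The process `ω_{ℓ,T}` with intermittency `λ²` and mean `μ`, driven by the noise of variance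
`λ² h^{-2} dh dt` over the domains `C_{ℓ,T}(t)`. -/
def IsMRMCutoff {Ω : Type*} [MeasurableSpace Ω] (W : (ℝ × ℝ → ℝ) → Ω → ℝ) (P : Measure Ω)
    (lam2 ℓ T mu : ℝ) (Y : Ω → C(ℝ, ℝ)) : Prop :=
  IsConeProcess W P lam2 0 ℓ T mu Y

/-- Weak convergence, as the parameter `i` in `S ⊆ ℝ` tends to `0`, of random measures: the laws
of `M i`, as Borel probability measures on the space of locally finite measures, converge weakly
to the law of `N`. -/
def WeakLimitAtZero {Ω : Type*} [MeasurableSpace Ω] (P : Measure Ω) [IsProbabilityMeasure P]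
    {S : Set ℝ} (M : S → Ω → LocFinMeasure) (N : Ω → LocFinMeasure) : Prop :=
  TendstoInDistribution M (comap ((↑) : S → ℝ) (𝓝 0)) N (fun _ => P) P

end LogSfBM

end

/-!
Why the theorem holds. Both `e^{ω_{H,T}(t)}` and `e^{ω_{ℓ,T}(t)}` are equal to `σ²` times the
normalised exponential `wickExp` of a Wiener integral of a kernel `(t', h) ↦ 1_{C_{0,T}(t)} g(h)`.
Everything thus depends only on the scale profile `g`, and the two approximations differ by it:
`g(h) = λ h^{H-1}` for the first, `g(h) = λ h^{-1} 1_{h > ℓ}` for the second. For small `H` and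
all `ℓ`, they belong to one class (`ScaleBound`): the variance of the scales above `2^{-n}` is at most
`λ² n log 2 + c`, and that of each dyadic band at most `c`.

Take `p ∈ (1, 2]` with `p λ² < 2`. Adding the band `(2^{-n-1}, 2^{-n}]` to the field changes
`∫ f e^X` by a martingale increment, which decouples between points at distance at least `2^{-n}`.
A von Bahr–Esseen inequality over blocks of that length
(`integral_abs_sum_rpow_le_of_blocks`) bounds its `L^p` norm by a constant times
`2^{-n (p - 1) (1 - p λ² / 2) / p}`, which is summable
(`IsWhiteNoise.exists_eLpNorm_riemannSum_trunc_sub_le`). Only finitely many points are used at a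
time: the estimates are for Riemann sums, uniform in the mesh, and pass to the integrals by Fatou's
lemma. The scales above a fixed `2^{-n}` converge in `L²` as the regularization is removed, so both
families of integrals converge in `L^p` to the same limit, for every continuous `f`
(`exists_tendsto_eLpNorm_pathIntegral`).

The vague topology is determined by a countable family of test functions (`testFun`). Along a
subsequence the integrals of all of them converge almost surely, and the Riesz–Markov–Kakutani
theorem provides the limit measure `M` (`exists_random_locFinMeasure`). Convergence in probability
of the integrals against the test functions gives convergence in distribution of the random measures
(`tendstoInDistribution_of_testFun`).

If `λ² < 1`, then `p = 2` is allowed, and `f = 1` on `[0, t]` gives convergence in `L²` of the masses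
of `[0, t]`. Their limit is the mass of `[0, t]` under `M`, as the mean mass that the approximating
measures put near the end points is bounded by `σ²` times Lebesgue measure (`real_Icc_ae_eq`).

Finally `ν_H² = λ² / (H (1 - 2 H))`, and the variance of `ω_{H,T}` is at least of order `1 / H`
(`le_integral_covDensity`), whence the limits of `ν_H²` and `m_H`.
-/

noncomputable section

namespace LogSfBM

/-! ### Wiener integrals and their exponentials -/

/-- The normalised exponential `exp (∫ f dW - ‖f‖² / 2)` of a Wiener integral; it has mean one. -/
def wickExp {Ω : Type*} (W : (ℝ × ℝ → ℝ) → Ω → ℝ) (f : ℝ × ℝ → ℝ) (a : Ω) : ℝ :=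
  Real.exp (W f a - (∫ p, f p ^ 2 ∂halfPlane) / 2)

section WhiteNoise

variable {Ω : Type*} [MeasurableSpace Ω] {P : Measure Ω} {W : (ℝ × ℝ → ℝ) → Ω → ℝ}

namespace IsWhiteNoise

lemma aemeasurable (hW : IsWhiteNoise W P) {f : ℝ × ℝ → ℝ} (hf : MemLp f 2 halfPlane) :
    AEMeasurable (W f) P := (hW.hasLaw f hf).aemeasurable

lemma map_add (hW : IsWhiteNoise W P) {f g : ℝ × ℝ → ℝ} (hf : MemLp f 2 halfPlane)
    (hg : MemLp g 2 halfPlane) : W (f + g) =ᵐ[P] W f + W g := by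
  simpa using hW.linear 1 1 f g hf hg

lemma map_sum (hW : IsWhiteNoise W P) {κ : Type*} (s : Finset κ) (c : κ → ℝ)
    (F : κ → ℝ × ℝ → ℝ) (hF : ∀ x, MemLp (F x) 2 halfPlane) :
    W (∑ x ∈ s, c x • F x) =ᵐ[P] ∑ x ∈ s, c x • W (F x) := by
  classical
  induction s using Finset.induction_on with
  | empty =>
    have h := hW.linear 0 0 0 0 MemLp.zero' MemLp.zero'
    simpa using h
  | insert x s hx ih =>
    rw [Finset.sum_insert hx, Finset.sum_insert hx]
    have h := hW.linear (c x) 1 (F x) (∑ x ∈ s, c x • F x) (hF x)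
      (memLp_finsetSum' s fun y _ => (hF y).const_smul (c y))
    rw [one_smul, one_smul] at h
    filter_upwards [h, ih] with a ha ha'
    rw [ha, Pi.add_apply, Pi.add_apply, ha']

lemma hasGaussianLaw_pi (hW : IsWhiteNoise W P) {κ : Type*} [Fintype κ]
    (F : κ → ℝ × ℝ → ℝ) (hF : ∀ x, MemLp (F x) 2 halfPlane) :
    HasGaussianLaw (fun a x => W (F x) a) P := by
  classical
  have hm : AEMeasurable (fun a x => W (F x) a) P :=
    aemeasurable_pi_lambda _ fun x => hW.aemeasurable (hF x)
  refine ⟨isGaussian_of_isGaussian_map fun L => ?_⟩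
  rw [AEMeasurable.map_map_of_aemeasurable (by fun_prop) hm]
  have hL : (L ∘ fun a x => W (F x) a) =ᵐ[P] W (∑ x, L (Pi.single x 1) • F x) := by
    filter_upwards [hW.map_sum Finset.univ (fun x => L (Pi.single x 1)) F hF] with a ha
    rw [ha, Function.comp_apply, Finset.sum_apply]
    conv_lhs => rw [pi_eq_sum_univ' (fun x => W (F x) a)]
    simp [mul_comm]
  rw [Measure.map_congr hL, (hW.hasLaw _ (memLp_finsetSum' _ fun y _ => (hF y).const_smul _)).map_eq]
  infer_instance

lemma integral_exp_mul (hW : IsWhiteNoise W P) {f : ℝ × ℝ → ℝ} (hf : MemLp f 2 halfPlane) (q : ℝ) :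
    ∫ a, Real.exp (q * W f a) ∂P = Real.exp ((∫ p, f p ^ 2 ∂halfPlane) * q ^ 2 / 2) := by
  have h := mgf_gaussianReal (hW.hasLaw f hf).map_eq q
  rw [mgf] at h
  rw [h, Real.coe_toNNReal _ (integral_nonneg fun _ => sq_nonneg _)]
  simp

lemma integrable_exp_mul (hW : IsWhiteNoise W P) {f : ℝ × ℝ → ℝ} (hf : MemLp f 2 halfPlane)
    (q : ℝ) : Integrable (fun a => Real.exp (q * W f a)) P := by
  have h := integrable_exp_mul_gaussianReal (μ := 0) (v := (∫ p, f p ^ 2 ∂halfPlane).toNNReal) q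
  rw [← (hW.hasLaw f hf).map_eq] at h
  exact (integrable_map_measure (by fun_prop) (hW.aemeasurable hf)).1 h

lemma variance_eq (hW : IsWhiteNoise W P) {f : ℝ × ℝ → ℝ} (hf : MemLp f 2 halfPlane) :
    Var[W f; P] = ∫ p, f p ^ 2 ∂halfPlane := by
  rw [(hW.hasLaw f hf).variance_eq]
  simp [Real.coe_toNNReal _ (integral_nonneg fun p => sq_nonneg (f p))]

lemma memLp_two (hW : IsWhiteNoise W P) {f : ℝ × ℝ → ℝ} (hf : MemLp f 2 halfPlane) :
    MemLp (W f) 2 P := (hW.hasLaw f hf).hasGaussianLaw.memLp_two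

lemma integral_add_sq {f g : ℝ × ℝ → ℝ} (hf : MemLp f 2 halfPlane) (hg : MemLp g 2 halfPlane) :
    ∫ p, (f + g) p ^ 2 ∂halfPlane = (∫ p, f p ^ 2 ∂halfPlane) + 2 * (∫ p, f p * g p ∂halfPlane) +
      ∫ p, g p ^ 2 ∂halfPlane := by
  have hfg : Integrable (fun p => f p * g p) halfPlane := hf.integrable_mul hg
  rw [← integral_const_mul, ← integral_add hf.integrable_sq (hfg.const_mul 2),
    ← integral_add (by exact hf.integrable_sq.add (hfg.const_mul 2)) hg.integrable_sq]
  exact integral_congr_ae (.of_forall fun p => by simp only [Pi.add_apply]; ring)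

lemma covariance_eq [IsProbabilityMeasure P] (hW : IsWhiteNoise W P) {f g : ℝ × ℝ → ℝ}
    (hf : MemLp f 2 halfPlane) (hg : MemLp g 2 halfPlane) :
    cov[W f, W g; P] = ∫ p, f p * g p ∂halfPlane := by
  have h := variance_add (hW.memLp_two hf) (hW.memLp_two hg)
  rw [← variance_congr (hW.map_add hf hg), hW.variance_eq (hf.add hg), hW.variance_eq hf,
    hW.variance_eq hg, integral_add_sq hf hg] at h
  linarith

/-- Wiener integrals of `F x` are jointly independent of that of `g` as soon as `g` is orthogonal
to all `F x`. -/
lemma indepFun [IsProbabilityMeasure P] (hW : IsWhiteNoise W P) {κ : Type*} [Fintype κ]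
    {F : κ → ℝ × ℝ → ℝ} {g : ℝ × ℝ → ℝ} (hF : ∀ x, MemLp (F x) 2 halfPlane)
    (hg : MemLp g 2 halfPlane) (h : ∀ x, ∫ p, F x p * g p ∂halfPlane = 0) :
    IndepFun (fun a x => W (F x) a) (W g) P := by
  have hG := hW.hasGaussianLaw_pi (fun o : Option κ => o.elim g F)
    (by rintro (_ | x); exacts [hg, hF x])
  let L : (Option κ → ℝ) →L[ℝ] (κ → ℝ) × (Unit → ℝ) :=
    (ContinuousLinearMap.pi fun x => .proj (some x)).prod
      (ContinuousLinearMap.pi fun _ => .proj none)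
  have h2 := (hG.map L).indepFun_of_covariance_eval (X := fun x => W (F x)) (Y := fun _ => W g)
    fun x _ => by rw [hW.covariance_eq (hF x) hg, h x]
  exact h2.comp (φ := id) (ψ := fun y : Unit → ℝ => y ()) measurable_id
    (measurable_pi_apply _)

lemma aemeasurable_wickExp (hW : IsWhiteNoise W P) {f : ℝ × ℝ → ℝ} (hf : MemLp f 2 halfPlane) :
    AEMeasurable (wickExp W f) P :=
  Real.measurable_exp.comp_aemeasurable ((hW.aemeasurable hf).sub_const _)

lemma wickExp_rpow {Ω : Type*} {W : (ℝ × ℝ → ℝ) → Ω → ℝ} (f : ℝ × ℝ → ℝ) (a : Ω) (q : ℝ) :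
    wickExp W f a ^ q =
    Real.exp (q * W f a) * Real.exp (-(q * (∫ p, f p ^ 2 ∂halfPlane) / 2)) := by
  rw [wickExp, ← Real.exp_mul, ← Real.exp_add]
  ring_nf

lemma integral_wickExp_rpow (hW : IsWhiteNoise W P) {f : ℝ × ℝ → ℝ} (hf : MemLp f 2 halfPlane)
    (q : ℝ) : ∫ a, wickExp W f a ^ q ∂P =
      Real.exp ((q ^ 2 - q) / 2 * ∫ p, f p ^ 2 ∂halfPlane) := by
  simp_rw [wickExp_rpow]
  rw [integral_mul_const, hW.integral_exp_mul hf, ← Real.exp_add]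
  ring_nf

lemma integrable_wickExp_rpow (hW : IsWhiteNoise W P) {f : ℝ × ℝ → ℝ} (hf : MemLp f 2 halfPlane)
    (q : ℝ) : Integrable (fun a => wickExp W f a ^ q) P := by
  simp_rw [wickExp_rpow]
  exact (hW.integrable_exp_mul hf q).mul_const _

lemma integral_wickExp (hW : IsWhiteNoise W P) {f : ℝ × ℝ → ℝ} (hf : MemLp f 2 halfPlane) :
    ∫ a, wickExp W f a ∂P = 1 := by
  simpa using hW.integral_wickExp_rpow hf 1

lemma memLp_wickExp (hW : IsWhiteNoise W P) {f : ℝ × ℝ → ℝ} (hf : MemLp f 2 halfPlane) :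
    MemLp (wickExp W f) 2 P := by
  rw [memLp_two_iff_integrable_sq (hW.aemeasurable_wickExp hf).aestronglyMeasurable]
  simpa using hW.integrable_wickExp_rpow hf 2

/-- The exponential of a sum factorises, up to the correlation. -/
lemma wickExp_mul (hW : IsWhiteNoise W P) {f g : ℝ × ℝ → ℝ} (hf : MemLp f 2 halfPlane)
    (hg : MemLp g 2 halfPlane) : (fun a => wickExp W f a * wickExp W g a) =ᵐ[P]
      fun a => Real.exp (∫ p, f p * g p ∂halfPlane) * wickExp W (f + g) a := by
  filter_upwards [hW.map_add hf hg] with a ha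
  rw [wickExp, wickExp, wickExp, ha, ← Real.exp_add, ← Real.exp_add, integral_add_sq hf hg,
    Pi.add_apply]
  ring_nf

lemma integral_wickExp_mul (hW : IsWhiteNoise W P) {f g : ℝ × ℝ → ℝ} (hf : MemLp f 2 halfPlane)
    (hg : MemLp g 2 halfPlane) :
    ∫ a, wickExp W f a * wickExp W g a ∂P = Real.exp (∫ p, f p * g p ∂halfPlane) := by
  rw [integral_congr_ae (hW.wickExp_mul hf hg), integral_const_mul,
    hW.integral_wickExp (hf.add hg), mul_one]

lemma integral_wickExp_sub_sq (hW : IsWhiteNoise W P) {f g : ℝ × ℝ → ℝ}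
    (hf : MemLp f 2 halfPlane) (hg : MemLp g 2 halfPlane) :
    ∫ a, (wickExp W f a - wickExp W g a) ^ 2 ∂P = Real.exp (∫ p, f p ^ 2 ∂halfPlane)
      - 2 * Real.exp (∫ p, f p * g p ∂halfPlane) + Real.exp (∫ p, g p ^ 2 ∂halfPlane) := by
  have h1 := hW.integral_wickExp_mul hf hf
  have h2 := hW.integral_wickExp_mul hf hg
  have h3 := hW.integral_wickExp_mul hg hg
  have i1 : Integrable (fun a => wickExp W f a * wickExp W f a) P :=
    (hW.memLp_wickExp hf).integrable_mul (hW.memLp_wickExp hf)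
  have i2 : Integrable (fun a => wickExp W f a * wickExp W g a) P :=
    (hW.memLp_wickExp hf).integrable_mul (hW.memLp_wickExp hg)
  have i3 : Integrable (fun a => wickExp W g a * wickExp W g a) P :=
    (hW.memLp_wickExp hg).integrable_mul (hW.memLp_wickExp hg)
  simp_rw [pow_two]
  rw [← h1, ← h2, ← h3, ← integral_const_mul, ← integral_sub i1 (i2.const_mul 2),
    ← integral_add (by exact i1.sub (i2.const_mul 2)) i3]
  exact integral_congr_ae (.of_forall fun a => by ring)

/-- Martingale property: conditioning on Wiener integrals of functions orthogonal to `g`, the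
exponential `wickExp (f + g)` averages to `wickExp f`. -/
lemma integral_mul_wickExp_add_sub [IsProbabilityMeasure P] (hW : IsWhiteNoise W P) {κ : Type*}
    [Fintype κ] {F : κ → ℝ × ℝ → ℝ} {g : ℝ × ℝ → ℝ} (hF : ∀ x, MemLp (F x) 2 halfPlane)
    (hg : MemLp g 2 halfPlane) (h : ∀ x, ∫ p, F x p * g p ∂halfPlane = 0) (x₀ : κ)
    {ψ : (κ → ℝ) → ℝ} (hψ : Measurable ψ) :
    ∫ a, ψ (fun x => W (F x) a) * (wickExp W (F x₀ + g) a - wickExp W (F x₀) a) ∂P = 0 := by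
  have hfac : (fun a => ψ (fun x => W (F x) a) * (wickExp W (F x₀ + g) a - wickExp W (F x₀) a))
      =ᵐ[P] fun a => (ψ (fun x => W (F x) a) * wickExp W (F x₀) a) * (wickExp W g a - 1) := by
    filter_upwards [hW.wickExp_mul (hF x₀) hg] with a ha
    rw [h x₀, Real.exp_zero, one_mul] at ha
    rw [← ha]
    ring
  have hind : IndepFun (fun a => ψ (fun x => W (F x) a) * wickExp W (F x₀) a)
      (fun a => wickExp W g a - 1) P :=
    (hW.indepFun hF hg h).comp
      (φ := fun y => ψ y * Real.exp (y x₀ - (∫ p, F x₀ p ^ 2 ∂halfPlane) / 2))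
      (ψ := fun y => Real.exp (y - (∫ p, g p ^ 2 ∂halfPlane) / 2) - 1)
      (by fun_prop) (by fun_prop)
  have hm : AEMeasurable (fun a x => W (F x) a) P :=
    aemeasurable_pi_lambda _ fun x => hW.aemeasurable (hF x)
  rw [integral_congr_ae hfac, hind.integral_fun_mul_eq_mul_integral
    ((hψ.comp_aemeasurable hm).mul (hW.aemeasurable_wickExp (hF x₀))).aestronglyMeasurable
    ((hW.aemeasurable_wickExp hg).sub_const 1).aestronglyMeasurable,
    integral_sub ((hW.memLp_wickExp hg).integrable (by norm_num)) (integrable_const 1),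
    hW.integral_wickExp hg]
  simp

end IsWhiteNoise

end WhiteNoise

/-! ### Moments of order `p ∈ (1, 2]` of sums of centred variables -/

/-- The function `x ↦ |x|^(p-2) x`, which is `p⁻¹` times the derivative of `|x|^p`. -/
def signedPow (p x : ℝ) : ℝ := |x| ^ (p - 2) * x

lemma signedPow_of_nonneg {p x : ℝ} (hp : 1 < p) (hx : 0 ≤ x) : signedPow p x = x ^ (p - 1) := by
  rcases hx.eq_or_lt with rfl | hx
  · rw [signedPow, mul_zero, Real.zero_rpow (by linarith)]
  · rw [signedPow, abs_of_pos hx, ← Real.rpow_add_one hx.ne']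
    ring_nf

lemma signedPow_neg (p x : ℝ) : signedPow p (-x) = -signedPow p x := by
  simp [signedPow]

lemma abs_signedPow {p : ℝ} (hp : 1 < p) (x : ℝ) : |signedPow p x| = |x| ^ (p - 1) := by
  rw [← signedPow_of_nonneg hp (abs_nonneg x), signedPow, signedPow, abs_mul, abs_abs,
    abs_of_nonneg (Real.rpow_nonneg (abs_nonneg x) _)]

@[fun_prop]
lemma measurable_signedPow (p : ℝ) : Measurable (signedPow p) := by
  unfold signedPow
  fun_prop

lemma rpow_sub_rpow_le {q x y : ℝ} (hq : 0 < q) (hq' : q ≤ 1) (hy : 0 ≤ y) (hxy : y ≤ x) :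
    |x ^ q - y ^ q| ≤ (x - y) ^ q := by
  have h := Real.rpow_add_le_add_rpow (sub_nonneg.2 hxy) hy hq.le hq'
  rw [sub_add_cancel] at h
  rw [abs_of_nonneg (sub_nonneg.2 (Real.rpow_le_rpow hy hxy hq.le))]
  linarith

lemma abs_signedPow_sub_le {p : ℝ} (hp : 1 < p) (hp' : p ≤ 2) (x y : ℝ) :
    |signedPow p x - signedPow p y| ≤ 2 * |x - y| ^ (p - 1) := by
  wlog hxy : y ≤ x generalizing x y
  · rw [abs_sub_comm, abs_sub_comm x]
    exact this y x (le_of_not_ge hxy)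
  have hq : 0 < p - 1 := by linarith
  have h0 : 0 ≤ (x - y) ^ (p - 1) := Real.rpow_nonneg (by linarith) _
  rw [abs_of_nonneg (sub_nonneg.2 hxy)]
  rcases le_total 0 y with hy | hy
  · rw [signedPow_of_nonneg hp hy, signedPow_of_nonneg hp (hy.trans hxy)]
    have := rpow_sub_rpow_le hq (by linarith) hy hxy
    linarith
  rcases le_total x 0 with hx | hx
  · have h1 := signedPow_neg p x
    have h2 := signedPow_neg p y
    rw [signedPow_of_nonneg hp (by linarith)] at h1 h2
    have := rpow_sub_rpow_le hq (by linarith) (neg_nonneg.2 hx) (neg_le_neg hxy)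
    rw [show signedPow p x - signedPow p y = (-y) ^ (p - 1) - (-x) ^ (p - 1) by linarith]
    rw [show -y - -x = x - y by ring] at this
    linarith
  · calc |signedPow p x - signedPow p y| ≤ |signedPow p x| + |signedPow p y| := abs_sub _ _
      _ = |x| ^ (p - 1) + |y| ^ (p - 1) := by rw [abs_signedPow hp, abs_signedPow hp]
      _ ≤ (x - y) ^ (p - 1) + (x - y) ^ (p - 1) := by
        gcongr
        · rw [abs_of_nonneg hx]; linarith
        · rw [abs_of_nonpos hy]; linarith
      _ = _ := by ring

lemma abs_add_rpow_le {p : ℝ} (hp : 1 < p) (hp' : p ≤ 2) (a b : ℝ) :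
    |a + b| ^ p ≤ |a| ^ p + p * (signedPow p a * b) + 4 * |b| ^ p := by
  -- the remainder of the first order expansion of `|·|^p`, whose derivative is Hölder
  set F : ℝ → ℝ := fun s => |a + s * b| ^ p with hF
  have hd : ∀ s, HasDerivAt F (p * signedPow p (a + s * b) * b) s := fun s => by
    have h1 := hasDerivAt_abs_rpow (a + s * b) hp
    have h2 : HasDerivAt (fun s => a + s * b) b s := by
      simpa using ((hasDerivAt_id s).mul_const b).const_add a
    have h3 := h1.comp s h2
    simpa [signedPow, mul_assoc, F, Function.comp_def] using h3
  obtain ⟨s, ⟨hs0, hs1⟩, hs⟩ := exists_hasDerivAt_eq_slope F _ zero_lt_one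
    (fun s _ => (hd s).continuousAt.continuousWithinAt) (fun s _ => hd s)
  have hs' : |a + b| ^ p - |a| ^ p = p * signedPow p (a + s * b) * b := by
    rw [hs]
    simp [hF]
  have hb : (signedPow p (a + s * b) - signedPow p a) * b ≤ 2 * |b| ^ p := by
    calc (signedPow p (a + s * b) - signedPow p a) * b
        ≤ |signedPow p (a + s * b) - signedPow p a| * |b| := by
          rw [← abs_mul]; exact le_abs_self _
      _ ≤ (2 * |a + s * b - a| ^ (p - 1)) * |b| := by
          gcongr; exact abs_signedPow_sub_le hp hp' _ _
      _ ≤ (2 * |b| ^ (p - 1)) * |b| := by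
          refine mul_le_mul_of_nonneg_right (mul_le_mul_of_nonneg_left (Real.rpow_le_rpow
            (abs_nonneg _) ?_ (by linarith)) (by norm_num)) (abs_nonneg b)
          rw [add_sub_cancel_left, abs_mul, abs_of_pos hs0]
          exact mul_le_of_le_one_left (abs_nonneg b) hs1.le
      _ = 2 * |b| ^ p := by
          rw [mul_assoc, ← Real.rpow_add_one' (abs_nonneg b) (by linarith)]
          ring_nf
  have h0 : 0 ≤ |b| ^ p := Real.rpow_nonneg (abs_nonneg b) _
  nlinarith

lemma add_rpow_le_four_mul {p x y : ℝ} (hp : 0 ≤ p) (hp' : p ≤ 2) (hx : 0 ≤ x) (hy : 0 ≤ y) :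
    (x + y) ^ p ≤ 4 * x ^ p + 4 * y ^ p := by
  wlog hxy : y ≤ x generalizing x y
  · rw [add_comm, add_comm (4 * x ^ p)]
    exact this hy hx (le_of_not_ge hxy)
  have h2 : (2 : ℝ) ^ p ≤ 4 :=
    (Real.rpow_le_rpow_of_exponent_le (by norm_num) hp').trans (by norm_num)
  have h3 := Real.rpow_nonneg hx p
  have h4 := Real.rpow_nonneg hy p
  calc (x + y) ^ p ≤ (2 * x) ^ p := Real.rpow_le_rpow (by positivity) (by linarith) hp
    _ = 2 ^ p * x ^ p := Real.mul_rpow (by norm_num) hx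
    _ ≤ 4 * x ^ p + 4 * y ^ p := by nlinarith

section MomentBound

variable {Ω : Type*} [MeasurableSpace Ω] {P : Measure Ω} [IsProbabilityMeasure P]

lemma integrable_abs_rpow {X : Ω → ℝ} (hX : MemLp X 2 P) {p : ℝ} (hp : 1 < p) (hp' : p ≤ 2) :
    Integrable (fun a => |X a| ^ p) P := by
  have h : MemLp X (ENNReal.ofReal p) P := hX.mono_exponent (by
    rw [← ENNReal.ofReal_ofNat]; exact ENNReal.ofReal_le_ofReal hp')
  have h2 := h.integrable_norm_rpow (by simp; linarith) (by simp)
  rwa [ENNReal.toReal_ofReal (by linarith)] at h2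

lemma integrable_signedPow_mul {X Y : Ω → ℝ} (hX : MemLp X 2 P) (hY : MemLp Y 2 P) {p : ℝ}
    (hp : 1 < p) (hp' : p ≤ 2) : Integrable (fun a => signedPow p (X a) * Y a) P := by
  have hb : Integrable (fun a => (1 + |X a|) * |Y a|) P :=
    MemLp.integrable_mul (p := 2) (q := 2) ((memLp_const (1 : ℝ)).add hX.abs) hY.abs
  refine hb.mono' (((measurable_signedPow p).comp_aemeasurable
    hX.aestronglyMeasurable.aemeasurable).aestronglyMeasurable.mul hY.aestronglyMeasurable)
    (.of_forall fun a => ?_)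
  rw [Real.norm_eq_abs, abs_mul, abs_signedPow hp]
  gcongr
  rcases le_total |X a| 1 with h | h
  · exact (Real.rpow_le_one (abs_nonneg _) h (by linarith)).trans (by simp)
  · calc |X a| ^ (p - 1) ≤ |X a| ^ (1 : ℝ) := Real.rpow_le_rpow_of_exponent_le h (by linarith)
      _ ≤ 1 + |X a| := by simp

/-- The von Bahr–Esseen inequality, under an orthogonality which holds as soon as each variable has
mean zero conditionally on the others. -/
lemma integral_abs_sum_rpow_le {ι : Type*} {p : ℝ} (hp : 1 < p) (hp' : p ≤ 2) (s : Finset ι)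
    {B : ι → Ω → ℝ} (hB : ∀ j, MemLp (B j) 2 P)
    (horth : ∀ j ∈ s, ∀ t ⊆ s, j ∉ t → ∫ a, signedPow p (∑ i ∈ t, B i a) * B j a ∂P = 0) :
    ∫ a, |∑ j ∈ s, B j a| ^ p ∂P ≤ 4 * ∑ j ∈ s, ∫ a, |B j a| ^ p ∂P := by
  classical
  induction s using Finset.induction_on with
  | empty => simp [Real.zero_rpow (by linarith : p ≠ 0)]
  | insert j s hj ih =>
    have ih := ih fun i hi t ht hit => horth i (Finset.mem_insert_of_mem hi) t
      (ht.trans (Finset.subset_insert _ _)) hit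
    have h0 := horth j (Finset.mem_insert_self _ _) s (Finset.subset_insert _ _) hj
    have hS : MemLp (fun a => ∑ i ∈ s, B i a) 2 P := memLp_finsetSum s fun i _ => hB i
    have i1 := integrable_abs_rpow hS hp hp'
    have i2 := (integrable_signedPow_mul hS (hB j) hp hp').const_mul p
    have i3 := (integrable_abs_rpow (hB j) hp hp').const_mul 4
    calc ∫ a, |∑ i ∈ insert j s, B i a| ^ p ∂P
        ≤ ∫ a, (|∑ i ∈ s, B i a| ^ p + p * (signedPow p (∑ i ∈ s, B i a) * B j a)
            + 4 * |B j a| ^ p) ∂P := by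
          refine integral_mono (integrable_abs_rpow (memLp_finsetSum _ fun i _ => hB i) hp hp')
            ((i1.add i2).add i3) fun a => ?_
          simp only
          rw [Finset.sum_insert hj, add_comm (B j a)]
          exact abs_add_rpow_le hp hp' _ _
      _ = ∫ a, |∑ i ∈ s, B i a| ^ p ∂P + 4 * ∫ a, |B j a| ^ p ∂P := by
          rw [integral_add (by exact i1.add i2) i3, integral_add i1 i2, integral_const_mul,
            integral_const_mul, h0]
          ring
      _ ≤ _ := by
          rw [Finset.sum_insert hj]
          linarith

/-- Sums over blocks: if the variables of distinct blocks of the same parity are orthogonal in the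
sense of `integral_abs_sum_rpow_le`, the `p`-th moment of the sum is controlled by those of the
terms and by the size `m` of the blocks. -/
lemma integral_abs_sum_rpow_le_of_blocks {ι : Type*} {p : ℝ} (hp : 1 < p) (hp' : p ≤ 2)
    (K : Finset ι) (blk : ι → ℤ) {Z : ι → Ω → ℝ} (hZ : ∀ k, MemLp (Z k) 2 P)
    (horth : ∀ k ∈ K, ∀ A ⊆ K, (∀ i ∈ A, blk i ≠ blk k ∧ (Even (blk i) ↔ Even (blk k))) →
      ∫ a, signedPow p (∑ i ∈ A, Z i a) * Z k a ∂P = 0)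
    {m : ℝ} (hm : ∀ j, ((K.filter fun k => blk k = j).card : ℝ) ≤ m) :
    ∫ a, |∑ k ∈ K, Z k a| ^ p ∂P ≤ 16 * m ^ (p - 1) * ∑ k ∈ K, ∫ a, |Z k a| ^ p ∂P := by
  classical
  have hclass : ∀ K' ⊆ K, (∀ i ∈ K', ∀ k ∈ K', (Even (blk i) ↔ Even (blk k))) →
      ∫ a, |∑ k ∈ K', Z k a| ^ p ∂P ≤ 4 * m ^ (p - 1) * ∑ k ∈ K', ∫ a, |Z k a| ^ p ∂P := by
    intro K' hK' hpar
    have hfib : ∀ g : ι → ℝ, ∑ k ∈ K', g k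
        = ∑ j ∈ K'.image blk, ∑ k ∈ K'.filter (fun k => blk k = j), g k := fun g =>
      (Finset.sum_fiberwise_of_maps_to (fun k hk => Finset.mem_image_of_mem blk hk) g).symm
    have hB : ∀ j, MemLp (fun a => ∑ k ∈ K'.filter (fun k => blk k = j), Z k a) 2 P :=
      fun j => memLp_finsetSum _ fun k _ => hZ k
    have h1 := integral_abs_sum_rpow_le hp hp' (K'.image blk) hB (P := P) (by
      intro j _ t _ hjt
      have ht : ∀ a, ∑ i ∈ t, ∑ k ∈ K'.filter (fun k => blk k = i), Z k a
          = ∑ k ∈ K'.filter (fun k => blk k ∈ t), Z k a := fun a => by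
        rw [← Finset.sum_fiberwise_of_maps_to (s := K'.filter (fun k => blk k ∈ t)) (g := blk)
          (t := t) (fun k hk => (Finset.mem_filter.1 hk).2)]
        refine Finset.sum_congr rfl fun i hi => Finset.sum_congr ?_ fun _ _ => rfl
        ext k
        simp only [Finset.mem_filter]
        constructor
        · rintro ⟨h1, rfl⟩; exact ⟨⟨h1, hi⟩, rfl⟩
        · rintro ⟨⟨h1, _⟩, h2⟩; exact ⟨h1, h2⟩
      simp_rw [ht, Finset.mul_sum]
      rw [integral_finsetSum _ fun k _ => integrable_signedPow_mul
        (memLp_finsetSum _ fun i _ => hZ i) (hZ k) hp hp']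
      refine Finset.sum_eq_zero fun k hk => ?_
      rw [Finset.mem_filter] at hk
      refine horth k (hK' hk.1) _ ((Finset.filter_subset _ _).trans hK') fun i hi => ?_
      rw [Finset.mem_filter] at hi
      refine ⟨?_, hpar i hi.1 k hk.1⟩
      rintro h
      rw [h, hk.2] at hi
      exact hjt hi.2)
    simp_rw [← hfib] at h1
    refine h1.trans ?_
    rw [hfib, mul_assoc]
    refine mul_le_mul_of_nonneg_left ?_ (by norm_num)
    rw [Finset.mul_sum]
    refine Finset.sum_le_sum fun j _ => ?_
    have hm' : ((K'.filter fun k => blk k = j).card : ℝ) ≤ m :=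
      le_trans (by exact_mod_cast Finset.card_le_card (Finset.filter_subset_filter _ hK')) (hm j)
    rw [← integral_finsetSum _ fun k _ => integrable_abs_rpow (hZ k) hp hp', ← integral_const_mul]
    refine integral_mono (integrable_abs_rpow (hB j) hp hp') ((integrable_finsetSum _ fun k _ =>
      integrable_abs_rpow (hZ k) hp hp').const_mul _) fun a => ?_
    simp only
    calc |∑ k ∈ K'.filter (fun k => blk k = j), Z k a| ^ p
        ≤ (∑ k ∈ K'.filter (fun k => blk k = j), |Z k a|) ^ p :=
          Real.rpow_le_rpow (abs_nonneg _) (Finset.abs_sum_le_sum_abs _ _) (by linarith)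
      _ ≤ ((K'.filter fun k => blk k = j).card : ℝ) ^ (p - 1) *
            ∑ k ∈ K'.filter (fun k => blk k = j), |Z k a| ^ p :=
          Real.rpow_sum_le_const_mul_sum_rpow _ _ hp.le
      _ ≤ _ := mul_le_mul_of_nonneg_right
          (Real.rpow_le_rpow (Nat.cast_nonneg _) hm' (by linarith))
          (Finset.sum_nonneg fun k _ => Real.rpow_nonneg (abs_nonneg _) _)
  have hE := hclass (K.filter fun k => Even (blk k)) (Finset.filter_subset _ _) (by simp_all)
  have hO := hclass (K.filter fun k => ¬ Even (blk k)) (Finset.filter_subset _ _) (by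
    intro i hi k hk
    rw [Finset.mem_filter] at hi hk
    tauto)
  have i1 := integrable_abs_rpow (P := P) (X := fun a => ∑ k ∈ K.filter (fun k => Even (blk k)), Z k a)
    (memLp_finsetSum _ fun k _ => hZ k) hp hp'
  have i2 := integrable_abs_rpow (P := P)
    (X := fun a => ∑ k ∈ K.filter (fun k => ¬ Even (blk k)), Z k a)
    (memLp_finsetSum _ fun k _ => hZ k) hp hp'
  calc ∫ a, |∑ k ∈ K, Z k a| ^ p ∂P
      ≤ ∫ a, (4 * |∑ k ∈ K.filter (fun k => Even (blk k)), Z k a| ^ p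
          + 4 * |∑ k ∈ K.filter (fun k => ¬ Even (blk k)), Z k a| ^ p) ∂P := by
        refine integral_mono (integrable_abs_rpow (memLp_finsetSum _ fun k _ => hZ k) hp hp')
          ((i1.const_mul 4).add (i2.const_mul 4)) fun a => ?_
        simp only
        rw [← Finset.sum_filter_add_sum_filter_not K (fun k => Even (blk k))]
        set x := ∑ k ∈ K.filter (fun k => Even (blk k)), Z k a
        set y := ∑ k ∈ K.filter (fun k => ¬ Even (blk k)), Z k a
        exact (Real.rpow_le_rpow (abs_nonneg _) (abs_add_le x y) (by linarith)).trans
          (add_rpow_le_four_mul (by linarith) hp' (abs_nonneg x) (abs_nonneg y))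
    _ = 4 * ∫ a, |∑ k ∈ K.filter (fun k => Even (blk k)), Z k a| ^ p ∂P
        + 4 * ∫ a, |∑ k ∈ K.filter (fun k => ¬ Even (blk k)), Z k a| ^ p ∂P := by
        rw [integral_add (i1.const_mul 4) (i2.const_mul 4), integral_const_mul, integral_const_mul]
    _ ≤ _ := by
        rw [← Finset.sum_filter_add_sum_filter_not K (fun k => Even (blk k))
          (fun k => ∫ a, |Z k a| ^ p ∂P)]
        linarith

end MomentBound

/-! ### Kernels supported by cones -/

/-- The measure `min (h, T) dh` on `(0, ∞)`: the law of the scale `h` under Lebesgue measure on the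
domain `C_{0,T}(t)`. -/
def scaleMeasure (T : ℝ) : Measure ℝ :=
  (volume.restrict (Set.Ioi 0)).withDensity fun h => ENNReal.ofReal (min h T)

/-- The kernel `(t', h) ↦ 1_{C_{0,T}(t)} g(h)`. -/
def kern (T : ℝ) (g : ℝ → ℝ) (t : ℝ) : ℝ × ℝ → ℝ := (cone 0 T t).indicator fun p => g p.2

lemma measurableSet_cone (ℓ T t : ℝ) : MeasurableSet (cone ℓ T t) := by
  unfold cone
  measurability

lemma coneKernel_eq_kern (c H T t : ℝ) {ℓ : ℝ} (hℓ : 0 ≤ ℓ) : coneKernel c H ℓ T t =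
    kern T ((Set.Ioi ℓ).indicator fun h => √c * h ^ (H - 1)) t := by
  ext p
  simp only [coneKernel, kern, Set.indicator_apply, cone, Set.mem_ofPred_eq, Set.mem_Ioi]
  by_cases h : ℓ < p.2
  · simp [h, hℓ.trans_lt h]
  · simp [h]

lemma map_snd_restrict_cone {T : ℝ} (t : ℝ) :
    (halfPlane.restrict (cone 0 T t)).map Prod.snd = scaleMeasure T := by
  have h0 : halfPlane.restrict (cone 0 T t) = volume.restrict (cone 0 T t) := by
    rw [halfPlane, Measure.restrict_restrict (measurableSet_cone 0 T t)]
    congr 1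
    exact Set.inter_eq_left.2 fun p hp => hp.1
  rw [h0]
  ext B hB
  rw [Measure.map_apply measurable_snd hB, Measure.restrict_apply (measurable_snd hB),
    Measure.volume_eq_prod, Measure.prod_apply_symm ((measurable_snd hB).inter
      (measurableSet_cone 0 T t)), scaleMeasure, withDensity_apply _ hB,
    Measure.restrict_restrict hB, ← lintegral_indicator (hB.inter measurableSet_Ioi)]
  refine lintegral_congr fun h => ?_
  by_cases hh : h ∈ B ∩ Set.Ioi 0
  · rw [Set.indicator_of_mem hh]
    have : (fun x => (x, h)) ⁻¹' (Prod.snd ⁻¹' B ∩ cone 0 T t) = Metric.ball t (min h T / 2) := by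
      ext x
      have h2 : 0 < h := hh.2
      simp [cone, hh.1, h2, Real.dist_eq]
    rw [this, Real.volume_ball]
    ring_nf
  · rw [Set.indicator_of_notMem hh]
    have : (fun x => (x, h)) ⁻¹' (Prod.snd ⁻¹' B ∩ cone 0 T t) = ∅ := by
      ext x
      simp only [Set.mem_preimage, Set.mem_inter_iff, Set.mem_empty_iff_false, iff_false]
      exact fun h1 => hh ⟨h1.1, h1.2.1⟩
    rw [this, measure_empty]

lemma memLp_kern {T : ℝ} {g : ℝ → ℝ} (hg : MemLp g 2 (scaleMeasure T)) (t : ℝ) :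
    MemLp (kern T g t) 2 halfPlane := by
  rw [kern, memLp_indicator_iff_restrict (measurableSet_cone 0 T t)]
  rw [← map_snd_restrict_cone t] at hg
  exact (memLp_map_measure_iff hg.aestronglyMeasurable measurable_snd.aemeasurable).1 hg

lemma integral_kern_mul {T : ℝ} {g g' : ℝ → ℝ} (hg : MemLp g 2 (scaleMeasure T))
    (hg' : MemLp g' 2 (scaleMeasure T)) (t : ℝ) :
    ∫ p, kern T g t p * kern T g' t p ∂halfPlane = ∫ h, g h * g' h ∂scaleMeasure T := by
  have h : (fun p => kern T g t p * kern T g' t p)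
      = (cone 0 T t).indicator fun p => g p.2 * g' p.2 := by
    ext p
    by_cases hp : p ∈ cone 0 T t <;> simp [kern, hp]
  have hm := hg.aestronglyMeasurable.mul hg'.aestronglyMeasurable
  rw [← map_snd_restrict_cone t] at hm ⊢
  rw [h, integral_indicator (measurableSet_cone 0 T t),
    integral_map measurable_snd.aemeasurable (by exact hm)]

lemma integral_kern_sq {T : ℝ} {g : ℝ → ℝ} (hg : MemLp g 2 (scaleMeasure T)) (t : ℝ) :
    ∫ p, kern T g t p ^ 2 ∂halfPlane = ∫ h, g h ^ 2 ∂scaleMeasure T := by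
  simpa [pow_two] using integral_kern_mul hg hg t

lemma integral_kern_mul_eq_zero (T t s : ℝ) {g g' : ℝ → ℝ} (h : ∀ x, g x * g' x = 0) :
    ∫ p, kern T g t p * kern T g' s p ∂halfPlane = 0 := by
  refine integral_eq_zero_of_ae (.of_forall fun p => ?_)
  classical
  simp only [kern, Set.indicator_apply, Pi.zero_apply]
  split_ifs <;> simp [h]

/-- Two cones at distance at least `ε` do not meet below height `ε`. -/
lemma integral_kern_mul_indicator_eq_zero (T : ℝ) {t s ε : ℝ} (hts : ε ≤ |t - s|) (ε' : ℝ)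
    (g g' : ℝ → ℝ) :
    ∫ p, kern T g t p * kern T ((Set.Ioc ε' ε).indicator g') s p ∂halfPlane = 0 := by
  refine integral_eq_zero_of_ae (.of_forall fun p => ?_)
  classical
  simp only [kern, Set.indicator_apply, Pi.zero_apply]
  split_ifs with h1 h3 h2
  · exfalso
    have h4 := min_le_left p.2 T
    have h5 := abs_sub_le t p.1 s
    have h6 := h1.2
    have h7 := h3.2
    rw [abs_sub_comm] at h6
    have := h2.2
    linarith
  all_goals simp

/-- The contribution to `g` of the scales above `ε`. -/
def trunc (ε : ℝ) (g : ℝ → ℝ) : ℝ → ℝ := (Set.Ioi ε).indicator g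

lemma memLp_trunc {T : ℝ} {g : ℝ → ℝ} (hg : MemLp g 2 (scaleMeasure T)) (ε : ℝ) :
    MemLp (trunc ε g) 2 (scaleMeasure T) := hg.indicator measurableSet_Ioi

lemma kern_trunc_eq_add (T : ℝ) (g : ℝ → ℝ) (t : ℝ) {ε' ε : ℝ} (h : ε' ≤ ε) :
    kern T (trunc ε' g) t = kern T (trunc ε g) t + kern T ((Set.Ioc ε' ε).indicator g) t := by
  ext p
  classical
  simp only [kern, trunc, Set.indicator_apply, Pi.add_apply, Set.mem_Ioi, Set.mem_Ioc]
  split_ifs <;> grind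

/-! ### Riemann sums -/

/-- The left Riemann sum of `u` over `[A, B]` with `N` steps. -/
def riemannSum (A B : ℝ) (N : ℕ) (u : ℝ → ℝ) : ℝ :=
  (B - A) / N * ∑ k ∈ Finset.range N, u (A + (B - A) / N * k)

lemma riemannSum_sub (A B : ℝ) (N : ℕ) (u v : ℝ → ℝ) :
    riemannSum A B N (fun t => u t - v t) = riemannSum A B N u - riemannSum A B N v := by
  rw [riemannSum, riemannSum, riemannSum, Finset.sum_sub_distrib, mul_sub]

/-- The Riemann sum of a continuous function over `[A, B]` converges to its integral. -/
lemma tendsto_riemannSum {A B : ℝ} (hAB : A ≤ B) {u : ℝ → ℝ} (hu : Continuous u) :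
    Tendsto (fun N => riemannSum A B N u) atTop (𝓝 (∫ t in A..B, u t)) := by
  rw [Metric.tendsto_atTop]
  intro ε hε
  have hη : 0 < ε / (B - A + 1) := div_pos hε (by linarith)
  have huc := isCompact_Icc.uniformContinuousOn_of_continuous (hu.continuousOn (s := Set.Icc A B))
  obtain ⟨d, hd, hdu⟩ := Metric.uniformContinuousOn_iff_le.1 huc _ hη
  obtain ⟨M, hM⟩ := exists_nat_gt ((B - A) / d)
  refine ⟨M + 1, fun N hN => ?_⟩
  have hN0 : (0 : ℝ) < N := by exact_mod_cast (by omega : 0 < N)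
  set δ := (B - A) / N with hδ
  have hδ0 : 0 ≤ δ := div_nonneg (by linarith) hN0.le
  have hδN : δ * N = B - A := div_mul_cancel₀ _ hN0.ne'
  have hδd : δ ≤ d := by
    rw [hδ, div_le_iff₀ hN0]
    rw [div_lt_iff₀ hd] at hM
    have : (M : ℝ) ≤ N := by exact_mod_cast (by omega : M ≤ N)
    nlinarith
  have hsplit : ∫ t in A..B, u t
      = ∑ k ∈ Finset.range N, ∫ t in (A + δ * k)..(A + δ * (k + 1 : ℕ)), u t := by
    rw [intervalIntegral.sum_integral_adjacent_intervals
      (a := fun k : ℕ => A + δ * k) fun k _ => hu.intervalIntegrable _ _, hδN]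
    simp
  have hterm : ∀ k ∈ Finset.range N,
      |δ * u (A + δ * k) - ∫ t in (A + δ * k)..(A + δ * (k + 1 : ℕ)), u t|
        ≤ ε / (B - A + 1) * δ := by
    intro k hk
    have hk' : ((k + 1 : ℕ) : ℝ) ≤ N := by exact_mod_cast Finset.mem_range.1 hk
    have hkk : A + δ * (k + 1 : ℕ) = A + δ * k + δ := by push_cast; ring
    have hkB : A + δ * k + δ ≤ B := by
      rw [← hkk]
      nlinarith [mul_le_mul_of_nonneg_left hk' hδ0]
    have hkA : A ≤ A + δ * k := by simp; positivity
    have h1 : δ * u (A + δ * k) = ∫ _ in (A + δ * k)..(A + δ * (k + 1 : ℕ)), u (A + δ * k) := by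
      rw [intervalIntegral.integral_const, hkk, smul_eq_mul]
      ring
    rw [h1, ← intervalIntegral.integral_sub (by simp) (hu.intervalIntegrable _ _), hkk,
      ← Real.norm_eq_abs]
    refine (intervalIntegral.norm_integral_le_of_norm_le_const (C := ε / (B - A + 1))
      fun t ht => ?_).trans (by rw [add_sub_cancel_left, abs_of_nonneg hδ0])
    rw [Set.uIoc_of_le (by linarith)] at ht
    have := hdu (A + δ * k) ⟨hkA, by linarith⟩ t ⟨by linarith [ht.1], by linarith [ht.2]⟩
      (by rw [Real.dist_eq, abs_le]; constructor <;> linarith [ht.1, ht.2])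
    rwa [Real.dist_eq] at this
  rw [riemannSum, hsplit, Finset.mul_sum, Real.dist_eq, ← Finset.sum_sub_distrib]
  calc _ ≤ ∑ k ∈ Finset.range N, ε / (B - A + 1) * δ :=
        (Finset.abs_sum_le_sum_abs _ _).trans (Finset.sum_le_sum hterm)
    _ = ε / (B - A + 1) * (B - A) := by
        rw [Finset.sum_const, Finset.card_range, nsmul_eq_mul, ← hδN]
        ring
    _ < ε := by
        rw [div_mul_eq_mul_div, div_lt_iff₀ (by linarith)]
        nlinarith

/-- An interval of length `ε ≥ δ` contains at most `ε / δ + 1 ≤ 2 * ε / δ` points of a progression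
of step `δ`. -/
lemma card_filter_floor_le (A : ℝ) {δ ε : ℝ} (hδ : 0 < δ) (hε : 0 < ε) (hδε : δ ≤ ε) (N : ℕ)
    (j : ℤ) : (((Finset.range N).filter fun k : ℕ => ⌊(A + δ * k) / ε⌋ = j).card : ℝ)
      ≤ 2 * ε / δ := by
  set s := (Finset.range N).filter fun k : ℕ => ⌊(A + δ * k) / ε⌋ = j with hs
  rcases s.eq_empty_or_nonempty with h | h
  · rw [h]; simp; positivity
  have hsub : s ⊆ Finset.Icc (s.min' h) (s.max' h) := fun k hk =>
    Finset.mem_Icc.2 ⟨Finset.min'_le _ _ hk, Finset.le_max' _ _ hk⟩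
  have hc := Finset.card_le_card hsub
  have hle := Finset.min'_le _ _ (s.max'_mem h)
  rw [Nat.card_Icc] at hc
  have hc' : (s.card : ℝ) ≤ s.max' h + 1 - s.min' h := by
    have : s.card + s.min' h ≤ s.max' h + 1 := by omega
    have : ((s.card + s.min' h : ℕ) : ℝ) ≤ ((s.max' h + 1 : ℕ) : ℝ) := by exact_mod_cast this
    push_cast at this
    linarith
  have h1 := (Finset.mem_filter.1 (s.min'_mem h)).2
  have h2 := (Finset.mem_filter.1 (s.max'_mem h)).2
  rw [Int.floor_eq_iff, le_div_iff₀ hε, div_lt_iff₀ hε] at h1 h2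
  rw [le_div_iff₀ hδ]
  nlinarith

/-! ### The effect of one band of scales -/

lemma wickExp_pos {Ω : Type*} {W : (ℝ × ℝ → ℝ) → Ω → ℝ} (f : ℝ × ℝ → ℝ) (a : Ω) :
    0 < wickExp W f a := Real.exp_pos _

section BandEstimate

variable {Ω : Type*} [MeasurableSpace Ω] {P : Measure Ω} [IsProbabilityMeasure P]
  {W : (ℝ × ℝ → ℝ) → Ω → ℝ}

namespace IsWhiteNoise

lemma integral_abs_wickExp_sub_one_rpow_le (hW : IsWhiteNoise W P) {g : ℝ × ℝ → ℝ}
    (hg : MemLp g 2 halfPlane) {p : ℝ} (hp : 1 < p) (hp' : p ≤ 2) :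
    ∫ a, |wickExp W g a - 1| ^ p ∂P ≤ Real.exp (∫ x, g x ^ 2 ∂halfPlane) := by
  have hgm : MemLp (fun a => wickExp W g a - 1) 2 P :=
    (hW.memLp_wickExp hg).sub (memLp_const (1 : ℝ))
  have hsq : ∀ x : ℝ, |x| ^ p ≤ 1 + x ^ 2 := fun x => by
    rcases le_total |x| 1 with h | h
    · exact (Real.rpow_le_one (abs_nonneg _) h (by linarith)).trans (by nlinarith)
    · calc |x| ^ p ≤ |x| ^ (2 : ℝ) := Real.rpow_le_rpow_of_exponent_le h hp'
        _ ≤ 1 + x ^ 2 := by simp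
  have h1 : Integrable (wickExp W g) P := (hW.memLp_wickExp hg).integrable (by norm_num)
  have h2 : Integrable (fun a => wickExp W g a * wickExp W g a) P :=
    (hW.memLp_wickExp hg).integrable_mul (hW.memLp_wickExp hg)
  have h3 : Integrable (fun a => 1 + (wickExp W g a - 1) ^ 2) P :=
    (integrable_const (1 : ℝ)).add hgm.integrable_sq
  have h4 : Integrable (fun a => 2 - 2 * wickExp W g a) P :=
    (integrable_const (2 : ℝ)).sub (h1.const_mul 2)
  have h5 : ∀ a, 1 + (wickExp W g a - 1) ^ 2
      = 2 - 2 * wickExp W g a + wickExp W g a * wickExp W g a := fun a => by ring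
  refine (integral_mono (integrable_abs_rpow hgm hp hp') h3 fun a => hsq _).trans_eq ?_
  simp_rw [h5]
  rw [integral_add h4 h2, integral_sub (integrable_const 2) (h1.const_mul 2), integral_const_mul,
    hW.integral_wickExp hg, hW.integral_wickExp_mul hg hg]
  simp [pow_two]

/-- The `p`-th moment of a martingale increment of the normalised exponential. -/
lemma integral_abs_wickExp_add_sub_rpow_le (hW : IsWhiteNoise W P) {f g : ℝ × ℝ → ℝ}
    (hf : MemLp f 2 halfPlane) (hg : MemLp g 2 halfPlane)
    (h : ∫ x, f x * g x ∂halfPlane = 0) {p : ℝ} (hp : 1 < p) (hp' : p ≤ 2) :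
    ∫ a, |wickExp W (f + g) a - wickExp W f a| ^ p ∂P ≤
      Real.exp ((p ^ 2 - p) / 2 * (∫ x, f x ^ 2 ∂halfPlane) + ∫ x, g x ^ 2 ∂halfPlane) := by
  have hfac : (fun a => |wickExp W (f + g) a - wickExp W f a| ^ p)
      =ᵐ[P] fun a => wickExp W f a ^ p * |wickExp W g a - 1| ^ p := by
    filter_upwards [hW.wickExp_mul hf hg] with a ha
    rw [h, Real.exp_zero, one_mul] at ha
    rw [← ha, ← mul_sub_one, abs_mul, Real.mul_rpow (abs_nonneg _) (abs_nonneg _),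
      abs_of_pos (wickExp_pos f a)]
  have hind₀ : IndepFun (wickExp W f) (wickExp W g) P :=
    (hW.indepFun (F := fun _ : Unit => f) (fun _ => hf) hg fun _ => h).comp
      (φ := fun y : Unit → ℝ => Real.exp (y () - (∫ x, f x ^ 2 ∂halfPlane) / 2))
      (ψ := fun y => Real.exp (y - (∫ x, g x ^ 2 ∂halfPlane) / 2)) (by fun_prop) (by fun_prop)
  have hind := hind₀.comp (φ := fun y => y ^ p) (ψ := fun y => |y - 1| ^ p)
    (by fun_prop) (by fun_prop)
  simp only [Function.comp_def] at hind
  have m1 := (hW.integrable_wickExp_rpow hf p).aestronglyMeasurable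
  have m2 : AEStronglyMeasurable (fun a => |wickExp W g a - 1| ^ p) P :=
    (((hW.aemeasurable_wickExp hg).sub_const 1).abs.pow_const p).aestronglyMeasurable
  rw [integral_congr_ae hfac, hind.integral_fun_mul_eq_mul_integral m1 m2,
    hW.integral_wickExp_rpow hf, Real.exp_add]
  exact mul_le_mul_of_nonneg_left (hW.integral_abs_wickExp_sub_one_rpow_le hg hp hp')
    (Real.exp_pos _).le

/-- Adding to the field the scales of `(ε', ε]` changes Riemann sums of mesh at most `ε` by a
quantity controlled in `L^p`, uniformly in the mesh. Points at distance more than `ε` see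
independent increments, so this is a von Bahr–Esseen estimate over blocks of length `ε`. -/
lemma integral_abs_riemannSum_sub_rpow_le (hW : IsWhiteNoise W P) {T : ℝ} {g : ℝ → ℝ}
    (hg : MemLp g 2 (scaleMeasure T)) {p : ℝ} (hp : 1 < p) (hp' : p ≤ 2) {A B : ℝ} (hAB : A ≤ B)
    {N : ℕ} {ε' ε : ℝ} (hε : 0 < ε) (hεε' : ε' ≤ ε) (hN : (B - A) / N ≤ ε) {f : ℝ → ℝ} {C : ℝ}
    (hf : ∀ t, |f t| ≤ C) :
    ∫ a, |riemannSum A B N fun t => f t *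
        (wickExp W (kern T (trunc ε' g) t) a - wickExp W (kern T (trunc ε g) t) a)| ^ p ∂P ≤
      16 * (2 * ε) ^ (p - 1) * (B - A) * C ^ p *
        Real.exp ((p ^ 2 - p) / 2 * (∫ h, trunc ε g h ^ 2 ∂scaleMeasure T)
          + ∫ h, (Set.Ioc ε' ε).indicator g h ^ 2 ∂scaleMeasure T) := by
  have hC : 0 ≤ C := (abs_nonneg _).trans (hf 0)
  set D := Real.exp ((p ^ 2 - p) / 2 * (∫ h, trunc ε g h ^ 2 ∂scaleMeasure T)
          + ∫ h, (Set.Ioc ε' ε).indicator g h ^ 2 ∂scaleMeasure T) with hD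
  have hBA : 0 ≤ B - A := sub_nonneg.2 hAB
  set δ := (B - A) / N with hδ
  have hδ0 : 0 ≤ δ := div_nonneg hBA (Nat.cast_nonneg _)
  rcases hδ0.eq_or_lt with h0 | hδpos
  · simp only [riemannSum, ← hδ, ← h0, zero_mul, abs_zero, Real.zero_rpow (by linarith : p ≠ 0),
      integral_zero]
    positivity
  have hmt := memLp_trunc hg
  have hmb : MemLp ((Set.Ioc ε' ε).indicator g) 2 (scaleMeasure T) := hg.indicator measurableSet_Ioc
  have horth0 : ∀ x, trunc ε g x * (Set.Ioc ε' ε).indicator g x = 0 := fun x => by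
    by_cases hx : ε < x
    · rw [Set.indicator_of_notMem (fun h => absurd h.2 (not_le.2 hx)), mul_zero]
    · rw [trunc, Set.indicator_of_notMem (by exact hx), zero_mul]
  set τ : ℕ → ℝ := fun k => A + δ * k with hτ
  set Z : ℕ → Ω → ℝ := fun k a => f (τ k) *
    (wickExp W (kern T (trunc ε' g) (τ k)) a - wickExp W (kern T (trunc ε g) (τ k)) a) with hZdef
  have hZ : ∀ k, MemLp (Z k) 2 P := fun k =>
    ((hW.memLp_wickExp (memLp_kern (hmt ε') _)).sub
      (hW.memLp_wickExp (memLp_kern (hmt ε) _))).const_mul _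
  have hblocks := integral_abs_sum_rpow_le_of_blocks (P := P) hp hp' (Finset.range N)
    (fun k => ⌊τ k / ε⌋) hZ (by
      intro k _ S _ hS
      -- the Wiener integrals which enter the sum over `S` and the coarse field at `τ k`
      let F : Option (S × Bool) → ℝ × ℝ → ℝ := fun o => match o with
        | none => kern T (trunc ε g) (τ k)
        | some (i, true) => kern T (trunc ε' g) (τ i)
        | some (i, false) => kern T (trunc ε g) (τ i)
      have hF : ∀ o, MemLp (F o) 2 halfPlane := by
        rintro (_ | ⟨i, _ | _⟩) <;> exact memLp_kern (hmt _) _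
      have hFo : ∀ o, ∫ q, F o q * kern T ((Set.Ioc ε' ε).indicator g) (τ k) q ∂halfPlane = 0 := by
        rintro (_ | ⟨i, _ | _⟩)
        · exact integral_kern_mul_eq_zero _ _ _ horth0
        · exact integral_kern_mul_eq_zero _ _ _ horth0
        · refine integral_kern_mul_indicator_eq_zero _ ?_ _ _ _
          obtain ⟨hne, hpar⟩ := hS i i.2
          -- distinct blocks of the same parity are at distance at least `ε`
          have h2 : 2 ≤ |⌊τ i / ε⌋ - ⌊τ k / ε⌋| := by
            have he : Even (⌊τ i / ε⌋ - ⌊τ k / ε⌋) := Int.even_sub.2 hpar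
            obtain ⟨r, hr⟩ := he
            rcases abs_cases (⌊τ i / ε⌋ - ⌊τ k / ε⌋) with h | h <;> omega
          have h3 : (2 : ℝ) ≤ |(⌊τ i / ε⌋ : ℝ) - ⌊τ k / ε⌋| := by exact_mod_cast h2
          have e1 : τ i / ε * ε = τ i := div_mul_cancel₀ _ hε.ne'
          have e2 : τ k / ε * ε = τ k := div_mul_cancel₀ _ hε.ne'
          have a1 := Int.floor_le (τ i / ε)
          have a2 := Int.lt_floor_add_one (τ i / ε)
          have a3 := Int.floor_le (τ k / ε)
          have a4 := Int.lt_floor_add_one (τ k / ε)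
          rw [le_abs] at h3 ⊢
          rcases h3 with h3 | h3
          · left; rw [← e1, ← e2]; nlinarith
          · right; rw [← e1, ← e2]; nlinarith
      have key := hW.integral_mul_wickExp_add_sub hF (memLp_kern hmb (τ k)) hFo none
        (ψ := fun y => signedPow p (∑ i : S, f (τ i) *
          (Real.exp (y (some (i, true)) - (∫ q, kern T (trunc ε' g) (τ i) q ^ 2 ∂halfPlane) / 2)
          - Real.exp (y (some (i, false)) - (∫ q, kern T (trunc ε g) (τ i) q ^ 2 ∂halfPlane) / 2))))
        (by fun_prop)
      have e : ∀ a, signedPow p (∑ i ∈ S, Z i a) * Z k a = f (τ k) * (signedPow p (∑ i : S, Z i a) *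
          (wickExp W (kern T (trunc ε g) (τ k) + kern T ((Set.Ioc ε' ε).indicator g) (τ k)) a
            - wickExp W (kern T (trunc ε g) (τ k)) a)) := fun a => by
        rw [Finset.sum_coe_sort S fun i => Z i a, ← kern_trunc_eq_add T g _ hεε']
        simp only [hZdef]
        ring
      simp_rw [e]
      rw [integral_const_mul]
      exact mul_eq_zero_of_right _ key)
    (m := 2 * ε / δ) (card_filter_floor_le A hδpos hε hN N)
  have hterm : ∀ k ∈ Finset.range N, ∫ a, |Z k a| ^ p ∂P ≤ C ^ p * D := fun k _ => by
    have h1 := hW.integral_abs_wickExp_add_sub_rpow_le (memLp_kern (hmt ε) (τ k))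
      (memLp_kern hmb (τ k)) (integral_kern_mul_eq_zero _ _ _ horth0) hp hp'
    rw [← kern_trunc_eq_add T g _ hεε', integral_kern_sq (hmt ε), integral_kern_sq hmb] at h1
    simp_rw [hZdef, abs_mul, Real.mul_rpow (abs_nonneg _) (abs_nonneg _)]
    rw [integral_const_mul]
    exact mul_le_mul (Real.rpow_le_rpow (abs_nonneg _) (hf _) (by linarith)) h1
      (integral_nonneg fun a => by positivity) (by positivity)
  have hsum := Finset.sum_le_sum hterm
  rw [Finset.sum_const, Finset.card_range, nsmul_eq_mul] at hsum
  have hN0 : (N : ℝ) ≠ 0 := fun h => by simp [hδ, h] at hδpos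
  have hδN : δ * N = B - A := div_mul_cancel₀ _ hN0
  have hpow : δ ^ p * (2 * ε / δ) ^ (p - 1) = δ * (2 * ε) ^ (p - 1) := by
    rw [Real.div_rpow (by positivity) hδ0, show p = 1 + (p - 1) by ring, Real.rpow_add hδpos,
      Real.rpow_one]
    have : δ ^ (p - 1) ≠ 0 := (Real.rpow_pos_of_pos hδpos _).ne'
    simp only [add_sub_cancel_left]
    field_simp
  calc _ = ∫ a, δ ^ p * |∑ k ∈ Finset.range N, Z k a| ^ p ∂P := by
        congr 1; ext a
        rw [riemannSum, abs_mul, Real.mul_rpow (abs_nonneg _) (abs_nonneg _), abs_of_nonneg hδ0]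
    _ = δ ^ p * ∫ a, |∑ k ∈ Finset.range N, Z k a| ^ p ∂P := integral_const_mul _ _
    _ ≤ δ ^ p * (16 * (2 * ε / δ) ^ (p - 1) * (N * (C ^ p * D))) := by
        refine mul_le_mul_of_nonneg_left (hblocks.trans ?_) (by positivity)
        exact mul_le_mul_of_nonneg_left hsum (by positivity)
    _ = 16 * (δ ^ p * (2 * ε / δ) ^ (p - 1)) * (N * (C ^ p * D)) := by ring
    _ = 16 * (2 * ε) ^ (p - 1) * (δ * N) * C ^ p * D := by rw [hpow]; ring
    _ = _ := by rw [hδN]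

end IsWhiteNoise

end BandEstimate

/-! ### Comparison of two fields through their large scales -/

/-- A bound, of the critical order `lam2 * log (1 / ε)` at `ε = 2 ^ (-n)`, on the variance of the
scales above `ε`, and a uniform bound on the variance of dyadic bands of scales. -/
structure ScaleBound (lam2 T c : ℝ) (g : ℝ → ℝ) : Prop where
  memLp : MemLp g 2 (scaleMeasure T)
  trunc_le : ∀ n : ℕ, ∫ h, trunc (2⁻¹ ^ n) g h ^ 2 ∂scaleMeasure T ≤ lam2 * (n * Real.log 2) + c
  band_le : ∀ n : ℕ,
    ∫ h, (Set.Ioc (2⁻¹ ^ (n + 1)) (2⁻¹ ^ n)).indicator g h ^ 2 ∂scaleMeasure T ≤ c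

/-- The `L²` distance between the normalised exponentials of the Wiener integrals of the kernels
`kern T g t` and `kern T g' t`. -/
def expDist (T : ℝ) (g g' : ℝ → ℝ) : ℝ :=
  √(Real.exp (∫ h, g h ^ 2 ∂scaleMeasure T) - 2 * Real.exp (∫ h, g h * g' h ∂scaleMeasure T)
    + Real.exp (∫ h, g' h ^ 2 ∂scaleMeasure T))

section Telescoping

variable {Ω : Type*} [MeasurableSpace Ω] {P : Measure Ω} {W : (ℝ × ℝ → ℝ) → Ω → ℝ}

lemma memLp_riemannSum {u : ℝ → Ω → ℝ} {q : ENNReal} (hu : ∀ t, MemLp (u t) q P) (A B : ℝ) (N : ℕ)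
    (f : ℝ → ℝ) : MemLp (fun a => riemannSum A B N fun t => f t * u t a) q P :=
  (memLp_finsetSum _ fun _ _ => (hu _).const_mul _).const_mul _

lemma memLp_riemannSum_sub {u v : ℝ → Ω → ℝ} {q : ENNReal} (hu : ∀ t, MemLp (u t) q P)
    (hv : ∀ t, MemLp (v t) q P) (A B : ℝ) (N : ℕ) (f : ℝ → ℝ) :
    MemLp (fun a => riemannSum A B N fun t => f t * (u t a - v t a)) q P :=
  memLp_riemannSum (fun t => (hu t).sub (hv t)) A B N f

lemma eLpNorm_riemannSum_le {u : ℝ → Ω → ℝ} {q b : ENNReal} (hq : 1 ≤ q)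
    (hu : ∀ t, MemLp (u t) q P) (hb : ∀ t, eLpNorm (u t) q P ≤ b) {A B : ℝ} (hAB : A ≤ B) (N : ℕ)
    {f : ℝ → ℝ} {C : ℝ} (hf : ∀ t, |f t| ≤ C) :
    eLpNorm (fun a => riemannSum A B N fun t => f t * u t a) q P
      ≤ ENNReal.ofReal (C * (B - A)) * b := by
  have hC : 0 ≤ C := (abs_nonneg _).trans (hf 0)
  set δ := (B - A) / N with hδ
  have hδ0 : 0 ≤ δ := div_nonneg (sub_nonneg.2 hAB) (Nat.cast_nonneg _)
  have hterm : ∀ k ∈ Finset.range N,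
      eLpNorm (fun a => f (A + δ * k) * u (A + δ * k) a) q P ≤ ENNReal.ofReal C * b := fun k _ => by
    change eLpNorm (f (A + δ * k) • u (A + δ * k)) q P ≤ _
    rw [eLpNorm_const_smul, Real.enorm_eq_ofReal_abs]
    exact mul_le_mul' (ENNReal.ofReal_le_ofReal (hf _)) (hb _)
  have hsum := (eLpNorm_sum_le (s := Finset.range N)
    (f := fun (k : ℕ) a => f (A + δ * k) * u (A + δ * k) a) (p := q) (μ := P)
    (fun k _ => ((hu _).const_mul _).aestronglyMeasurable) hq).trans (Finset.sum_le_sum hterm)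
  have e : (fun a => riemannSum A B N fun t => f t * u t a)
      = δ • ∑ k ∈ Finset.range N, fun a => f (A + δ * (k : ℕ)) * u (A + δ * (k : ℕ)) a := by
    ext a
    simp [riemannSum, hδ]
  rw [e, eLpNorm_const_smul, Real.enorm_eq_ofReal_abs, abs_of_nonneg hδ0]
  refine (mul_le_mul_right hsum _).trans ?_
  rw [Finset.sum_const, Finset.card_range, nsmul_eq_mul, ← mul_assoc, ← mul_assoc,
    ← ENNReal.ofReal_natCast, ← ENNReal.ofReal_mul hδ0, ← ENNReal.ofReal_mul (by positivity)]
  refine mul_le_mul_left (ENNReal.ofReal_le_ofReal ?_) _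
  rcases Nat.eq_zero_or_pos N with h | h
  · subst h; simp; exact mul_nonneg hC (sub_nonneg.2 hAB)
  · rw [hδ, div_mul_cancel₀ _ (by positivity), mul_comm]

lemma eLpNorm_eq_ofReal [IsProbabilityMeasure P] {X : Ω → ℝ} (hX : MemLp X 2 P) {p : ℝ}
    (hp : 1 < p) (hp' : p ≤ 2) :
    eLpNorm X (ENNReal.ofReal p) P = ENNReal.ofReal ((∫ a, |X a| ^ p ∂P) ^ p⁻¹) := by
  have h : MemLp X (ENNReal.ofReal p) P := hX.mono_exponent (by
    rw [← ENNReal.ofReal_ofNat]; exact ENNReal.ofReal_le_ofReal hp')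
  rw [h.eLpNorm_eq_integral_rpow_norm (by simp; linarith) (by simp),
    ENNReal.toReal_ofReal (by linarith)]
  simp

variable [IsProbabilityMeasure P]

namespace IsWhiteNoise

lemma eLpNorm_wickExp_sub (hW : IsWhiteNoise W P) {T : ℝ} {g g' : ℝ → ℝ}
    (hg : MemLp g 2 (scaleMeasure T)) (hg' : MemLp g' 2 (scaleMeasure T)) (t : ℝ) :
    eLpNorm (fun a => wickExp W (kern T g t) a - wickExp W (kern T g' t) a) 2 P
      = ENNReal.ofReal (expDist T g g') := by
  have h := eLpNorm_eq_ofReal (P := P) (p := 2) ((hW.memLp_wickExp (memLp_kern hg t)).sub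
    (hW.memLp_wickExp (memLp_kern hg' t))) (by norm_num) le_rfl
  rw [ENNReal.ofReal_ofNat] at h
  have h2 := hW.integral_wickExp_sub_sq (memLp_kern hg t) (memLp_kern hg' t)
  rw [integral_kern_sq hg, integral_kern_sq hg', integral_kern_mul hg hg'] at h2
  rw [expDist, ← h2, Real.sqrt_eq_rpow]
  refine h.trans ?_
  simp

lemma eLpNorm_riemannSum_sub_le_expDist (hW : IsWhiteNoise W P) {T : ℝ} {g g' : ℝ → ℝ}
    (hg : MemLp g 2 (scaleMeasure T)) (hg' : MemLp g' 2 (scaleMeasure T)) {q : ENNReal}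
    (hq : 1 ≤ q) (hq' : q ≤ 2) {A B : ℝ} (hAB : A ≤ B) (N : ℕ) {f : ℝ → ℝ} {C : ℝ}
    (hf : ∀ t, |f t| ≤ C) :
    eLpNorm (fun a => riemannSum A B N fun t => f t *
        (wickExp W (kern T g t) a - wickExp W (kern T g' t) a)) q P
      ≤ ENNReal.ofReal (C * (B - A) * expDist T g g') := by
  have hC : 0 ≤ C := (abs_nonneg _).trans (hf 0)
  rw [ENNReal.ofReal_mul (mul_nonneg hC (sub_nonneg.2 hAB))]
  have hm : ∀ t, MemLp (fun a => wickExp W (kern T g t) a - wickExp W (kern T g' t) a) 2 P :=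
    fun t => (hW.memLp_wickExp (memLp_kern hg t)).sub (hW.memLp_wickExp (memLp_kern hg' t))
  refine eLpNorm_riemannSum_le hq (fun t => (hm t).mono_exponent hq') (fun t => ?_) hAB N hf
  rw [← hW.eLpNorm_wickExp_sub hg hg' t]
  exact eLpNorm_le_eLpNorm_of_exponent_le hq' (hm t).aestronglyMeasurable

/-- Refining a field from scale `2 ^ (-n)` to scale `2 ^ (-m)` changes Riemann sums by at most a
geometrically small quantity `K * s ^ n` in `L^p`: each band of scales contributes
`2 ^ (-n (p - 1) (1 - p * lam2 / 2) / p)`, and the exponent is negative as `p * lam2 < 2`. -/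
lemma exists_eLpNorm_riemannSum_trunc_sub_le (hW : IsWhiteNoise W P) {lam2 T c p : ℝ}
    (hp : 1 < p) (hp' : p ≤ 2) (hplam : p * lam2 < 2) {A B : ℝ} (hAB : A ≤ B) (C : ℝ) :
    ∃ K s : ℝ, 0 ≤ K ∧ 0 < s ∧ s < 1 ∧ ∀ f : ℝ → ℝ, (∀ t, |f t| ≤ C) → ∀ g,
      ScaleBound lam2 T c g → ∀ n m N : ℕ, n ≤ m → (B - A) / N ≤ 2⁻¹ ^ m →
        eLpNorm (fun a => riemannSum A B N fun t => f t * (wickExp W (kern T (trunc (2⁻¹ ^ m) g) t) a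
          - wickExp W (kern T (trunc (2⁻¹ ^ n) g) t) a)) (ENNReal.ofReal p) P
        ≤ ENNReal.ofReal (K * s ^ n) := by
  set K₀ := 16 * 2 ^ (p - 1) * (B - A) * C ^ p * Real.exp ((p ^ 2 - p) / 2 * c + c) with hK₀
  set r := Real.exp (-((p - 1) * (1 - p * lam2 / 2) * Real.log 2)) with hr
  have hlog : 0 < Real.log 2 := Real.log_pos one_lt_two
  have hr1 : r < 1 := by
    rw [hr, Real.exp_lt_one_iff, neg_lt_zero]
    exact mul_pos (mul_pos (by linarith) (by linarith)) hlog
  set s := r ^ p⁻¹ with hs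
  have hs0 : 0 < s := Real.rpow_pos_of_pos (Real.exp_pos _) _
  have hs1 : s < 1 := Real.rpow_lt_one (Real.exp_pos _).le hr1 (by positivity)
  set K := K₀ ^ p⁻¹ with hK
  refine ⟨max K 0 / (1 - s), s, div_nonneg (le_max_right _ _) (by linarith), hs0, hs1,
    fun f hf g hg n m N hnm hN => ?_⟩
  have hC : 0 ≤ C := (abs_nonneg _).trans (hf 0)
  have hBA : 0 ≤ B - A := sub_nonneg.2 hAB
  have hK₀0 : 0 ≤ K₀ := by positivity
  have hK0 : 0 ≤ K := Real.rpow_nonneg hK₀0 _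
  rw [max_eq_left hK0]
  have hm2 : ∀ k t, MemLp (wickExp W (kern T (trunc (2⁻¹ ^ k) g) t)) 2 P := fun k t =>
    hW.memLp_wickExp (memLp_kern (memLp_trunc hg.memLp _) t)
  have hq1 : 1 ≤ ENNReal.ofReal p := by
    rw [← ENNReal.ofReal_one]; exact ENNReal.ofReal_le_ofReal hp.le
  -- one band of scales
  have hstep : ∀ k, (B - A) / N ≤ 2⁻¹ ^ k → eLpNorm (fun a => riemannSum A B N fun t => f t *
      (wickExp W (kern T (trunc (2⁻¹ ^ (k + 1)) g) t) a
        - wickExp W (kern T (trunc (2⁻¹ ^ k) g) t) a)) (ENNReal.ofReal p) P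
      ≤ ENNReal.ofReal (K * s ^ k) := by
    intro k hk
    rw [eLpNorm_eq_ofReal (memLp_riemannSum_sub (hm2 (k + 1)) (hm2 k) A B N f) hp hp']
    refine ENNReal.ofReal_le_ofReal ?_
    have hKs : K * s ^ k = (K₀ * r ^ k) ^ p⁻¹ := by
      rw [Real.mul_rpow hK₀0 (pow_nonneg (Real.exp_pos _).le _), hK, hs, ← Real.rpow_natCast,
        ← Real.rpow_natCast, ← Real.rpow_mul (Real.exp_pos _).le,
        ← Real.rpow_mul (Real.exp_pos _).le, mul_comm p⁻¹]
    rw [hKs]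
    refine Real.rpow_le_rpow (integral_nonneg fun a => by positivity) ?_ (by positivity)
    refine (hW.integral_abs_riemannSum_sub_rpow_le hg.memLp hp hp' hAB (by positivity)
      (pow_le_pow_of_le_one (by norm_num) (by norm_num) (Nat.le_succ k)) hk hf).trans ?_
    have hpp : 0 ≤ (p ^ 2 - p) / 2 := by nlinarith
    have hpow : (2 * (2⁻¹ : ℝ) ^ k) ^ (p - 1)
        = 2 ^ (p - 1) * Real.exp (-(k * (p - 1) * Real.log 2)) := by
      rw [Real.mul_rpow (by norm_num) (by positivity), ← Real.rpow_natCast, ← Real.rpow_mul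
        (by norm_num), Real.inv_rpow (by norm_num), Real.rpow_def_of_pos (by norm_num : (0:ℝ) < 2)
        (k * (p - 1)), ← Real.exp_neg]
      ring_nf
    calc _ ≤ 16 * (2 * (2⁻¹ : ℝ) ^ k) ^ (p - 1) * (B - A) * C ^ p *
          Real.exp ((p ^ 2 - p) / 2 * (lam2 * (k * Real.log 2) + c) + c) := by
          gcongr
          · exact hg.trunc_le k
          · exact hg.band_le k
      _ = 16 * 2 ^ (p - 1) * (B - A) * C ^ p * (Real.exp (-(k * (p - 1) * Real.log 2)) *
          Real.exp ((p ^ 2 - p) / 2 * (lam2 * (k * Real.log 2) + c) + c)) := by rw [hpow]; ring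
      _ = K₀ * r ^ k := by
          rw [hK₀, hr, ← Real.exp_nat_mul, mul_assoc _ (Real.exp _) (Real.exp _), ← Real.exp_add,
            ← Real.exp_add]
          ring_nf
  -- the geometric series
  have hind : eLpNorm (fun a => riemannSum A B N fun t => f t *
      (wickExp W (kern T (trunc (2⁻¹ ^ m) g) t) a - wickExp W (kern T (trunc (2⁻¹ ^ n) g) t) a))
      (ENNReal.ofReal p) P ≤ ENNReal.ofReal (K * (s ^ n - s ^ m) / (1 - s)) := by
    induction m, hnm using Nat.le_induction with
    | base => simp [riemannSum]
    | succ m hnm ih =>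
      have hN' : (B - A) / N ≤ 2⁻¹ ^ m :=
        hN.trans (pow_le_pow_of_le_one (by norm_num) (by norm_num) (Nat.le_succ m))
      have e : (fun a => riemannSum A B N fun t => f t *
          (wickExp W (kern T (trunc (2⁻¹ ^ (m + 1)) g) t) a
            - wickExp W (kern T (trunc (2⁻¹ ^ n) g) t) a))
          = (fun a => riemannSum A B N fun t => f t *
            (wickExp W (kern T (trunc (2⁻¹ ^ m) g) t) a
              - wickExp W (kern T (trunc (2⁻¹ ^ n) g) t) a)) +
            (fun a => riemannSum A B N fun t => f t *
            (wickExp W (kern T (trunc (2⁻¹ ^ (m + 1)) g) t) a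
              - wickExp W (kern T (trunc (2⁻¹ ^ m) g) t) a)) := by
        ext a
        simp only [riemannSum, Pi.add_apply, ← mul_add, ← Finset.sum_add_distrib]
        congr 1
        refine Finset.sum_congr rfl fun k _ => ?_
        ring
      rw [e]
      refine (eLpNorm_add_le (memLp_riemannSum_sub (hm2 m) (hm2 n) A B N f).aestronglyMeasurable
        (memLp_riemannSum_sub (hm2 (m + 1)) (hm2 m) A B N f).aestronglyMeasurable hq1).trans
        ((add_le_add (ih hN') (hstep m hN')).trans_eq ?_)
      have hsnm : s ^ m ≤ s ^ n := pow_le_pow_of_le_one hs0.le hs1.le hnm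
      rw [← ENNReal.ofReal_add (div_nonneg (mul_nonneg hK0 (by linarith)) (by linarith))
        (mul_nonneg hK0 (by positivity))]
      congr 1
      have : 1 - s ≠ 0 := by linarith
      field_simp
      ring
  refine hind.trans (ENNReal.ofReal_le_ofReal ?_)
  rw [div_mul_eq_mul_div]
  have : 0 ≤ s ^ m := by positivity
  refine div_le_div_of_nonneg_right ?_ (by linarith)
  nlinarith

end IsWhiteNoise

end Telescoping

/-! ### Integrals of the exponential of a continuous field -/

/-- `e^X` is `sigma2` times the normalised exponential of the Wiener integrals of the kernels
`kern T g t`. -/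
structure IsExpField {Ω : Type*} [MeasurableSpace Ω] (W : (ℝ × ℝ → ℝ) → Ω → ℝ) (P : Measure Ω)
    (T sigma2 : ℝ) (g : ℝ → ℝ) (X : Ω → C(ℝ, ℝ)) : Prop where
  memLp : MemLp g 2 (scaleMeasure T)
  ae_eq : ∀ t, ∀ᵐ a ∂P, Real.exp (X a t) = sigma2 * wickExp W (kern T g t) a

/-- The integral of `f` over `[A, B]` against the measure `e^{X(t)} dt`. -/
def pathIntegral {Ω : Type*} (A B : ℝ) (f : ℝ → ℝ) (X : Ω → C(ℝ, ℝ)) (a : Ω) : ℝ :=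
  ∫ t in A..B, f t * Real.exp (X a t)

section PathIntegral

variable {Ω : Type*} [MeasurableSpace Ω] {P : Measure Ω} {W : (ℝ × ℝ → ℝ) → Ω → ℝ}
  {T sigma2 : ℝ} {g : ℝ → ℝ} {X : Ω → C(ℝ, ℝ)} {A B : ℝ} {f : ℝ → ℝ} {C : ℝ}

lemma IsExpField.ae_tendsto_riemannSum (hX : IsExpField W P T sigma2 g X) (hAB : A ≤ B)
    (hfc : Continuous f) : ∀ᵐ a ∂P, Tendsto
      (fun N => sigma2 * riemannSum A B N fun t => f t * wickExp W (kern T g t) a) atTop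
      (𝓝 (pathIntegral A B f X a)) := by
  have h : ∀ᵐ a ∂P, ∀ N k : ℕ, Real.exp (X a (A + (B - A) / N * k))
      = sigma2 * wickExp W (kern T g (A + (B - A) / N * k)) a :=
    ae_all_iff.2 fun N => ae_all_iff.2 fun k => hX.ae_eq _
  filter_upwards [h] with a ha
  have := tendsto_riemannSum hAB (hfc.mul (Real.continuous_exp.comp (X a).continuous))
  refine this.congr fun N => ?_
  simp only [riemannSum, Pi.mul_apply, Function.comp_apply, ha, Finset.mul_sum]
  exact Finset.sum_congr rfl fun k _ => by ring

lemma IsExpField.memLp_riemannSum (hW : IsWhiteNoise W P) (hX : IsExpField W P T sigma2 g X)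
    (A B : ℝ) (f : ℝ → ℝ) (N : ℕ) : MemLp
      (fun a => sigma2 * riemannSum A B N fun t => f t * wickExp W (kern T g t) a) 2 P :=
  (LogSfBM.memLp_riemannSum (fun t => hW.memLp_wickExp (memLp_kern hX.memLp t)) A B N f).const_mul _

lemma IsExpField.aestronglyMeasurable_pathIntegral (hW : IsWhiteNoise W P)
    (hX : IsExpField W P T sigma2 g X) (hAB : A ≤ B) (hfc : Continuous f) :
    AEStronglyMeasurable (pathIntegral A B f X) P :=
  aestronglyMeasurable_of_tendsto_ae atTop
    (fun N => (hX.memLp_riemannSum hW A B f N).aestronglyMeasurable)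
    (hX.ae_tendsto_riemannSum hAB hfc)

variable [IsProbabilityMeasure P]

lemma IsExpField.eLpNorm_pathIntegral_le (hW : IsWhiteNoise W P)
    (hX : IsExpField W P T sigma2 g X) (hs : 0 ≤ sigma2) (hAB : A ≤ B) (hfc : Continuous f)
    (hf : ∀ t, |f t| ≤ C) {q b : ENNReal} (hq : 1 ≤ q) (hq' : q ≤ 2)
    (hb : ∀ t, eLpNorm (wickExp W (kern T g t)) q P ≤ b) :
    eLpNorm (pathIntegral A B f X) q P ≤ ENNReal.ofReal sigma2 * (ENNReal.ofReal (C * (B - A)) * b) := by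
  refine (Lp.eLpNorm_lim_le_liminf_eLpNorm
    (fun N => (hX.memLp_riemannSum hW A B f N).aestronglyMeasurable) _
    (hX.ae_tendsto_riemannSum hAB hfc)).trans (liminf_le_of_frequently_le' (.of_forall fun N => ?_))
  change eLpNorm (sigma2 • fun a => riemannSum A B N fun t => f t * wickExp W (kern T g t) a) q P ≤ _
  rw [eLpNorm_const_smul, Real.enorm_eq_ofReal hs]
  exact mul_le_mul_right (eLpNorm_riemannSum_le hq
    (fun t => (hW.memLp_wickExp (memLp_kern hX.memLp t)).mono_exponent hq') hb hAB N hf) _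

/-- The first moment bound coming from `E[e^{X(t)}] = sigma2`. -/
lemma IsExpField.eLpNorm_one_pathIntegral_le (hW : IsWhiteNoise W P)
    (hX : IsExpField W P T sigma2 g X) (hs : 0 ≤ sigma2) (hAB : A ≤ B) (hfc : Continuous f)
    (hf : ∀ t, |f t| ≤ C) :
    eLpNorm (pathIntegral A B f X) 1 P ≤ ENNReal.ofReal (sigma2 * C * (B - A)) := by
  refine (hX.eLpNorm_pathIntegral_le hW hs hAB hfc hf (b := 1) le_rfl (by norm_num)
    fun t => ?_).trans_eq ?_
  · have h1 := hW.memLp_wickExp (memLp_kern hX.memLp t)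
    rw [eLpNorm_one_eq_lintegral_enorm]
    simp_rw [Real.enorm_eq_ofReal (wickExp_pos _ _).le]
    rw [← ofReal_integral_eq_lintegral_ofReal (h1.integrable (by norm_num))
      (.of_forall fun a => (wickExp_pos _ a).le), hW.integral_wickExp (memLp_kern hX.memLp t)]
    simp
  · rw [mul_one, ← ENNReal.ofReal_mul hs, mul_assoc]

lemma IsExpField.memLp_pathIntegral (hW : IsWhiteNoise W P) (hX : IsExpField W P T sigma2 g X)
    (hs : 0 ≤ sigma2) (hAB : A ≤ B) (hfc : Continuous f) (hf : ∀ t, |f t| ≤ C) :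
    MemLp (pathIntegral A B f X) 2 P := by
  refine ⟨hX.aestronglyMeasurable_pathIntegral hW hAB hfc, ?_⟩
  refine (hX.eLpNorm_pathIntegral_le hW hs hAB hfc hf
    (b := ENNReal.ofReal (Real.exp (∫ h, g h ^ 2 ∂scaleMeasure T) ^ (2 : ℝ)⁻¹))
    (by norm_num) le_rfl fun t => le_of_eq ?_).trans_lt ?_
  · have h1 := hW.memLp_wickExp (memLp_kern hX.memLp t)
    have h := eLpNorm_eq_ofReal h1 (p := 2) (by norm_num) le_rfl
    have h2 := hW.integral_wickExp_rpow (memLp_kern hX.memLp t) 2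
    rw [ENNReal.ofReal_ofNat] at h
    simp_rw [abs_of_pos (wickExp_pos _ _)] at h
    rw [h, h2, integral_kern_sq hX.memLp]
    norm_num
  · exact ENNReal.mul_lt_top ENNReal.ofReal_lt_top
      (ENNReal.mul_lt_top ENNReal.ofReal_lt_top ENNReal.ofReal_lt_top)

lemma tendsto_expDist_trunc (hg : MemLp g 2 (scaleMeasure T)) :
    Tendsto (fun m : ℕ => expDist T g (trunc (2⁻¹ ^ m) g)) atTop (𝓝 0) := by
  have hpos : ∀ᵐ h ∂scaleMeasure T, (0 : ℝ) < h :=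
    (withDensity_absolutelyContinuous _ _).ae_le (ae_restrict_mem measurableSet_Ioi)
  have hmul : ∀ ε h, g h * trunc ε g h = trunc ε g h ^ 2 := fun ε h => by
    by_cases hh : ε < h <;> simp [trunc, hh, pow_two]
  have hle : ∀ ε h, trunc ε g h ^ 2 ≤ g h ^ 2 := fun ε h => by
    by_cases hh : ε < h <;> simp [trunc, hh, sq_nonneg]
  have hlim : Tendsto (fun m : ℕ => ∫ h, trunc (2⁻¹ ^ m) g h ^ 2 ∂scaleMeasure T) atTop
      (𝓝 (∫ h, g h ^ 2 ∂scaleMeasure T)) := by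
    refine tendsto_integral_of_dominated_convergence (fun h => g h ^ 2)
      (fun m => (memLp_trunc hg _).integrable_sq.aestronglyMeasurable) hg.integrable_sq
      (fun m => .of_forall fun h => ?_) (hpos.mono fun h hh => ?_)
    · rw [Real.norm_eq_abs, abs_of_nonneg (sq_nonneg _)]
      exact hle _ _
    · refine tendsto_const_nhds.congr' ?_
      have := (tendsto_pow_atTop_nhds_zero_of_lt_one (r := (2⁻¹ : ℝ)) (by norm_num)
        (by norm_num)).eventually (gt_mem_nhds hh)
      filter_upwards [this] with m hm
      rw [trunc, Set.indicator_of_mem (by exact hm)]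
  have h2 : Tendsto (fun m : ℕ => expDist T g (trunc (2⁻¹ ^ m) g)) atTop
      (𝓝 √(Real.exp (∫ h, g h ^ 2 ∂scaleMeasure T) - 2 * Real.exp (∫ h, g h ^ 2 ∂scaleMeasure T)
        + Real.exp (∫ h, g h ^ 2 ∂scaleMeasure T))) := by
    simp only [expDist, hmul]
    have h3 := (Real.continuous_exp.tendsto _).comp hlim
    exact (Real.continuous_sqrt.tendsto _).comp ((tendsto_const_nhds.sub (h3.const_mul 2)).add h3)
  rwa [show ∀ x : ℝ, x - 2 * x + x = 0 from fun x => by ring, Real.sqrt_zero] at h2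

/-- Two fields whose scales above `2 ^ (-n)` are close have close integrals in `L^p`, up to an error
which is geometrically small in `n` and uniform in the class `ScaleBound`. -/
lemma IsWhiteNoise.exists_eLpNorm_pathIntegral_sub_le (hW : IsWhiteNoise W P) {lam2 c p : ℝ}
    (hp : 1 < p) (hp' : p ≤ 2) (hplam : p * lam2 < 2) (hs : 0 ≤ sigma2) (hAB : A ≤ B) (C : ℝ) :
    ∃ K s : ℝ, 0 ≤ K ∧ 0 < s ∧ s < 1 ∧ ∀ f : ℝ → ℝ, Continuous f → (∀ t, |f t| ≤ C) →
      ∀ (g₁ g₂ : ℝ → ℝ) (X₁ X₂ : Ω → C(ℝ, ℝ)), ScaleBound lam2 T c g₁ → ScaleBound lam2 T c g₂ →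
      IsExpField W P T sigma2 g₁ X₁ → IsExpField W P T sigma2 g₂ X₂ → ∀ n : ℕ,
      eLpNorm (fun a => pathIntegral A B f X₁ a - pathIntegral A B f X₂ a) (ENNReal.ofReal p) P
        ≤ ENNReal.ofReal (sigma2 * (2 * (K * s ^ n)
          + C * (B - A) * expDist T (trunc (2⁻¹ ^ n) g₁) (trunc (2⁻¹ ^ n) g₂))) := by
  obtain ⟨K, s, hK, hs0, hs1, H⟩ := hW.exists_eLpNorm_riemannSum_trunc_sub_le (T := T) (c := c)
    hp hp' hplam hAB C
  refine ⟨K, s, hK, hs0, hs1, fun f hfc hf g₁ g₂ X₁ X₂ hg₁ hg₂ hX₁ hX₂ n => ?_⟩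
  have hC : 0 ≤ C := (abs_nonneg _).trans (hf 0)
  have hBA : 0 ≤ C * (B - A) := mul_nonneg hC (sub_nonneg.2 hAB)
  have hq1 : 1 ≤ ENNReal.ofReal p := by
    rw [← ENNReal.ofReal_one]; exact ENNReal.ofReal_le_ofReal hp.le
  have hq2 : ENNReal.ofReal p ≤ 2 := by
    rw [← ENNReal.ofReal_ofNat]; exact ENNReal.ofReal_le_ofReal hp'
  have hd0 : ∀ g g' : ℝ → ℝ, 0 ≤ expDist T g g' := fun _ _ => Real.sqrt_nonneg _
  set e : ℕ → ℝ := fun m => sigma2 * (C * (B - A) * expDist T g₁ (trunc (2⁻¹ ^ m) g₁) + K * s ^ n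
    + C * (B - A) * expDist T (trunc (2⁻¹ ^ n) g₁) (trunc (2⁻¹ ^ n) g₂) + K * s ^ n
    + C * (B - A) * expDist T g₂ (trunc (2⁻¹ ^ m) g₂)) with he
  have hlim : Tendsto (fun m => ENNReal.ofReal (e m)) atTop (𝓝 (ENNReal.ofReal (sigma2 *
      (2 * (K * s ^ n) + C * (B - A) * expDist T (trunc (2⁻¹ ^ n) g₁) (trunc (2⁻¹ ^ n) g₂))))) := by
    refine (ENNReal.continuous_ofReal.tendsto _).comp ?_
    have h1 := (tendsto_expDist_trunc hg₁.memLp).const_mul (C * (B - A))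
    have h2 := (tendsto_expDist_trunc hg₂.memLp).const_mul (C * (B - A))
    have := (((((h1.add_const (K * s ^ n)).add_const (C * (B - A) *
      expDist T (trunc (2⁻¹ ^ n) g₁) (trunc (2⁻¹ ^ n) g₂))).add_const (K * s ^ n)).add h2).const_mul
      sigma2)
    convert this using 2
    ring
  refine ge_of_tendsto hlim (eventually_atTop.2 ⟨n, fun m hnm => ?_⟩)
  -- the mesh tends to zero, with the scale `2 ^ (-m)` fixed
  have hconv : ∀ᵐ a ∂P, Tendsto (fun N =>
      (sigma2 * riemannSum A B N fun t => f t * wickExp W (kern T g₁ t) a) -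
      sigma2 * riemannSum A B N fun t => f t * wickExp W (kern T g₂ t) a) atTop
      (𝓝 (pathIntegral A B f X₁ a - pathIntegral A B f X₂ a)) := by
    filter_upwards [hX₁.ae_tendsto_riemannSum hAB hfc, hX₂.ae_tendsto_riemannSum hAB hfc]
      with a h1 h2 using h1.sub h2
  refine (Lp.eLpNorm_lim_le_liminf_eLpNorm (fun N => ((hX₁.memLp_riemannSum hW A B f N).sub
    (hX₂.memLp_riemannSum hW A B f N)).aestronglyMeasurable) _ hconv).trans
    (liminf_le_of_frequently_le' (Eventually.frequently ?_))
  have hmesh : ∀ᶠ N : ℕ in atTop, (B - A) / N ≤ 2⁻¹ ^ m :=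
    (tendsto_const_div_atTop_nhds_zero_nat (B - A)).eventually (ge_mem_nhds (by positivity))
  filter_upwards [hmesh] with N hN
  let D : (ℝ → ℝ) → (ℝ → ℝ) → Ω → ℝ := fun g g' a => riemannSum A B N fun t => f t *
    (wickExp W (kern T g t) a - wickExp W (kern T g' t) a)
  have hDm : ∀ g g', MemLp g 2 (scaleMeasure T) → MemLp g' 2 (scaleMeasure T) →
      AEStronglyMeasurable (D g g') P := fun g g' hg hg' =>
    (memLp_riemannSum_sub (fun t => hW.memLp_wickExp (memLp_kern hg t))
      (fun t => hW.memLp_wickExp (memLp_kern hg' t)) A B N f).aestronglyMeasurable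
  have hdecomp : (fun a => (sigma2 * riemannSum A B N fun t => f t * wickExp W (kern T g₁ t) a) -
      sigma2 * riemannSum A B N fun t => f t * wickExp W (kern T g₂ t) a)
      = sigma2 • (D g₁ (trunc (2⁻¹ ^ m) g₁) + D (trunc (2⁻¹ ^ m) g₁) (trunc (2⁻¹ ^ n) g₁)
        + D (trunc (2⁻¹ ^ n) g₁) (trunc (2⁻¹ ^ n) g₂)
        - D (trunc (2⁻¹ ^ m) g₂) (trunc (2⁻¹ ^ n) g₂) - D g₂ (trunc (2⁻¹ ^ m) g₂)) := by
    ext a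
    simp only [D, mul_sub, riemannSum_sub, Pi.smul_apply, Pi.add_apply, Pi.sub_apply, smul_eq_mul]
    ring
  have t₁ := fun k : ℕ => memLp_trunc hg₁.memLp (2⁻¹ ^ k)
  have t₂ := fun k : ℕ => memLp_trunc hg₂.memLp (2⁻¹ ^ k)
  have b₁ := hW.eLpNorm_riemannSum_sub_le_expDist hg₁.memLp (t₁ m) hq1 hq2 hAB N hf
  have b₂ := H f hf g₁ hg₁ n m N hnm hN
  have b₃ := hW.eLpNorm_riemannSum_sub_le_expDist (t₁ n) (t₂ n) hq1 hq2 hAB N hf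
  have b₄ := H f hf g₂ hg₂ n m N hnm hN
  have b₅ := hW.eLpNorm_riemannSum_sub_le_expDist hg₂.memLp (t₂ m) hq1 hq2 hAB N hf
  have m₁ := hDm _ _ hg₁.memLp (t₁ m)
  have m₂ := hDm _ _ (t₁ m) (t₁ n)
  have m₃ := hDm _ _ (t₁ n) (t₂ n)
  have m₄ := hDm _ _ (t₂ m) (t₂ n)
  have m₅ := hDm _ _ hg₂.memLp (t₂ m)
  change eLpNorm (fun a => (sigma2 * riemannSum A B N fun t => f t * wickExp W (kern T g₁ t) a) -
      sigma2 * riemannSum A B N fun t => f t * wickExp W (kern T g₂ t) a) _ P ≤ _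
  rw [hdecomp, eLpNorm_const_smul, Real.enorm_eq_ofReal hs, he, ENNReal.ofReal_mul hs,
    ENNReal.ofReal_add, ENNReal.ofReal_add, ENNReal.ofReal_add, ENNReal.ofReal_add]
  · refine mul_le_mul_right ?_ _
    refine (eLpNorm_sub_le (((m₁.add m₂).add m₃).sub m₄) m₅ hq1).trans (add_le_add ?_ b₅)
    refine (eLpNorm_sub_le ((m₁.add m₂).add m₃) m₄ hq1).trans (add_le_add ?_ b₄)
    refine (eLpNorm_add_le (m₁.add m₂) m₃ hq1).trans (add_le_add ?_ b₃)
    exact (eLpNorm_add_le m₁ m₂ hq1).trans (add_le_add b₁ b₂)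
  all_goals
    have := mul_nonneg hK (pow_nonneg hs0.le n)
    have := mul_nonneg hBA (hd0 g₁ (trunc (2⁻¹ ^ m) g₁))
    have := mul_nonneg hBA (hd0 (trunc (2⁻¹ ^ n) g₁) (trunc (2⁻¹ ^ n) g₂))
    have := mul_nonneg hBA (hd0 g₂ (trunc (2⁻¹ ^ m) g₂))
    linarith

end PathIntegral

/-! ### Power kernels -/

/-- The kernel `√lam2 * h ^ (H - 1)` restricted to the scales in `S`. -/
def powKernel (lam2 H : ℝ) (S : Set ℝ) : ℝ → ℝ := S.indicator fun h => √lam2 * h ^ (H - 1)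

/-- The covariance density `min (h, T) * lam2 * h ^ (s - 2)` of power kernels over one cone. -/
def covDensity (lam2 T s h : ℝ) : ℝ := min h T * (lam2 * h ^ (s - 2))

/-- A majorant of `covDensity 1 T s` for all `s ∈ [0, 1 / 2]`. -/
def covMajorant (T h : ℝ) : ℝ := if h ≤ 1 then h⁻¹ else T * h ^ (-(3 / 2) : ℝ)

section PowKernel

variable {lam2 T : ℝ}

lemma covDensity_nonneg (hlam : 0 ≤ lam2) (hT : 0 < T) (s : ℝ) {h : ℝ} (hh : 0 < h) :
    0 ≤ covDensity lam2 T s h :=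
  mul_nonneg (le_min hh.le hT.le) (mul_nonneg hlam (Real.rpow_nonneg hh.le _))

@[fun_prop]
lemma measurable_covDensity (lam2 T s : ℝ) : Measurable (covDensity lam2 T s) := by
  unfold covDensity
  fun_prop

lemma covDensity_le_covMajorant (hlam : 0 ≤ lam2) (hT : 0 < T) {s h : ℝ} (hs : 0 ≤ s)
    (hs' : s ≤ 1 / 2) (hh : 0 < h) : covDensity lam2 T s h ≤ lam2 * covMajorant T h := by
  rw [covDensity, mul_left_comm]
  refine mul_le_mul_of_nonneg_left ?_ hlam
  rw [covMajorant]
  split_ifs with h1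
  · calc min h T * h ^ (s - 2) ≤ h * h ^ (-2 : ℝ) := by
          refine mul_le_mul (min_le_left _ _) ?_ (Real.rpow_nonneg hh.le _) hh.le
          exact Real.rpow_le_rpow_of_exponent_ge hh h1 (by linarith)
      _ = h⁻¹ := by
          rw [Real.rpow_neg hh.le, Real.rpow_two]
          field_simp
  · refine mul_le_mul (min_le_right _ _) ?_ (Real.rpow_nonneg hh.le _) hT.le
    exact Real.rpow_le_rpow_of_exponent_le (not_le.1 h1).le (by linarith)

lemma integrableOn_covMajorant {ε : ℝ} (hε : 0 < ε) (hε' : ε ≤ 1) :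
    IntegrableOn (covMajorant T) (Set.Ioi ε) ∧
      ∫ h in Set.Ioi ε, covMajorant T h = Real.log ε⁻¹ + 2 * T := by
  have e1 : Set.EqOn (covMajorant T) (fun h => h⁻¹) (Set.Ioc ε 1) := fun h hh => if_pos hh.2
  have e2 : Set.EqOn (covMajorant T) (fun h => T * h ^ (-(3 / 2) : ℝ)) (Set.Ioi 1) :=
    fun h hh => if_neg (not_le.2 hh)
  have i1 : IntegrableOn (covMajorant T) (Set.Ioc ε 1) := by
    rw [integrableOn_congr_fun e1 measurableSet_Ioc, ← intervalIntegrable_iff_integrableOn_Ioc_of_le hε']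
    exact intervalIntegral.intervalIntegrable_inv (fun x hx => by
      rw [Set.uIcc_of_le hε'] at hx; exact (hε.trans_le hx.1).ne') continuousOn_id
  have i2 : IntegrableOn (covMajorant T) (Set.Ioi 1) := by
    rw [integrableOn_congr_fun e2 measurableSet_Ioi]
    exact (integrableOn_Ioi_rpow_of_lt (by norm_num) one_pos).const_mul T
  rw [← Set.Ioc_union_Ioi_eq_Ioi hε']
  refine ⟨i1.union i2, ?_⟩
  rw [setIntegral_union (Set.Ioc_disjoint_Ioi le_rfl) measurableSet_Ioi i1 i2,
    setIntegral_congr_fun measurableSet_Ioc e1, setIntegral_congr_fun measurableSet_Ioi e2,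
    ← intervalIntegral.integral_of_le hε', integral_inv_of_pos hε one_pos, integral_const_mul,
    integral_Ioi_rpow_of_lt (by norm_num) one_pos]
  norm_num
  ring

lemma integrableOn_covDensity_of_pos (hlam : 0 ≤ lam2) (hT : 0 < T) {s ε : ℝ} (hs : 0 ≤ s)
    (hs' : s ≤ 1 / 2) (hε : 0 < ε) : IntegrableOn (covDensity lam2 T s) (Set.Ioi ε) := by
  have h1 : IntegrableOn (covMajorant T) (Set.Ioi ε) :=
    (integrableOn_covMajorant (ε := min ε 1) (by positivity) (min_le_right _ _)).1.mono_set
      (Set.Ioi_subset_Ioi (min_le_left _ _))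
  refine (h1.const_mul lam2).mono' (measurable_covDensity _ _ _).aestronglyMeasurable ?_
  filter_upwards [ae_restrict_mem measurableSet_Ioi] with h hh
  have hh : 0 < h := hε.trans hh
  rw [Real.norm_eq_abs, abs_of_nonneg (covDensity_nonneg hlam hT s hh)]
  exact covDensity_le_covMajorant hlam hT hs hs' hh

lemma integrableOn_covDensity_zero (hlam : 0 ≤ lam2) (hT : 0 < T) {s : ℝ} (hs : 0 < s)
    (hs' : s < 1) : IntegrableOn (covDensity lam2 T s) (Set.Ioi 0) := by
  rw [← Set.Ioc_union_Ioi_eq_Ioi zero_le_one]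
  refine IntegrableOn.union ?_ ?_
  · have h1 : IntegrableOn (fun h : ℝ => h ^ (s - 1)) (Set.Ioc 0 1) := by
      rw [← intervalIntegrable_iff_integrableOn_Ioc_of_le zero_le_one]
      exact intervalIntegral.intervalIntegrable_rpow' (by linarith)
    refine (h1.const_mul lam2).mono' (measurable_covDensity _ _ _).aestronglyMeasurable ?_
    filter_upwards [ae_restrict_mem measurableSet_Ioc] with h hh
    rw [Real.norm_eq_abs, abs_of_nonneg (covDensity_nonneg hlam hT s hh.1), covDensity, mul_left_comm]
    refine mul_le_mul_of_nonneg_left ?_ hlam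
    calc min h T * h ^ (s - 2) ≤ h ^ (s - 2) * h := by
          rw [mul_comm]
          exact mul_le_mul_of_nonneg_left (min_le_left _ _) (Real.rpow_nonneg hh.1.le _)
      _ = h ^ (s - 1) := by
          rw [← Real.rpow_add_one hh.1.ne']
          ring_nf
  · have h1 : IntegrableOn (fun h : ℝ => h ^ (s - 2)) (Set.Ioi 1) :=
      integrableOn_Ioi_rpow_of_lt (by linarith) one_pos
    refine (h1.const_mul (T * lam2)).mono' (measurable_covDensity _ _ _).aestronglyMeasurable ?_
    filter_upwards [ae_restrict_mem measurableSet_Ioi] with h hh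
    have hh : (0 : ℝ) < h := one_pos.trans hh
    rw [Real.norm_eq_abs, abs_of_nonneg (covDensity_nonneg hlam hT s hh), covDensity, mul_assoc]
    exact mul_le_mul_of_nonneg_right (min_le_right _ _)
      (mul_nonneg hlam (Real.rpow_nonneg hh.le _))

/-- As `H → 0`, the variance of the S-fBM is at least of order `1 / H`. -/
lemma le_integral_covDensity (hlam : 0 ≤ lam2) (hT : 0 < T) {s : ℝ} (hs : 0 < s) (hs' : s < 1) :
    lam2 * min 1 T / s ≤ ∫ h in Set.Ioi 0, covDensity lam2 T s h := by
  set τ := min 1 T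
  have hτ : 0 < τ := lt_min one_pos hT
  have hi := integrableOn_covDensity_zero hlam hT hs hs'
  have h1 : ∫ h in Set.Ioc 0 τ, covDensity lam2 T s h = lam2 * (τ ^ s / s) := by
    have e : Set.EqOn (covDensity lam2 T s) (fun h => lam2 * h ^ (s - 1)) (Set.Ioc 0 τ) := by
      intro h hh
      simp only [covDensity]
      rw [min_eq_left (hh.2.trans (min_le_right _ _)), mul_left_comm, mul_comm h,
        ← Real.rpow_add_one hh.1.ne']
      ring_nf
    rw [setIntegral_congr_fun measurableSet_Ioc e, integral_const_mul,
      ← intervalIntegral.integral_of_le hτ.le, integral_rpow (Or.inl (by linarith)),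
      sub_add_cancel, Real.zero_rpow hs.ne', sub_zero]
  calc lam2 * τ / s ≤ lam2 * (τ ^ s / s) := by
        rw [mul_div_assoc]
        gcongr
        calc τ = τ ^ (1 : ℝ) := (Real.rpow_one _).symm
          _ ≤ τ ^ s := Real.rpow_le_rpow_of_exponent_ge hτ (min_le_left _ _) hs'.le
    _ = ∫ h in Set.Ioc 0 τ, covDensity lam2 T s h := h1.symm
    _ ≤ _ := setIntegral_mono_set hi ((ae_restrict_mem measurableSet_Ioi).mono fun h hh =>
        covDensity_nonneg hlam hT s hh) Set.Ioc_subset_Ioi_self.eventuallyLE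

lemma measurable_powKernel (lam2 H : ℝ) {S : Set ℝ} (hS : MeasurableSet S) :
    Measurable (powKernel lam2 H S) :=
  Measurable.indicator (by fun_prop) hS

lemma integral_scaleMeasure (hT : 0 < T) (u : ℝ → ℝ) :
    ∫ h, u h ∂scaleMeasure T = ∫ h in Set.Ioi 0, min h T * u h := by
  rw [scaleMeasure, integral_withDensity_eq_integral_toReal_smul (by fun_prop)
    (.of_forall fun _ => ENNReal.ofReal_lt_top)]
  refine setIntegral_congr_fun measurableSet_Ioi fun h hh => ?_
  simp only [smul_eq_mul]
  rw [ENNReal.toReal_ofReal (le_min (le_of_lt hh) hT.le)]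

lemma powKernel_mul (hlam : 0 ≤ lam2) (T H H' : ℝ) {S : Set ℝ} (hS0 : S ⊆ Set.Ioi 0) (h : ℝ) :
    min h T * (powKernel lam2 H S h * powKernel lam2 H' S h)
      = S.indicator (covDensity lam2 T (H + H')) h := by
  by_cases hh : h ∈ S
  · have h0 : 0 < h := hS0 hh
    simp only [powKernel, covDensity, Set.indicator_of_mem hh]
    rw [mul_mul_mul_comm, Real.mul_self_sqrt hlam, ← Real.rpow_add h0]
    ring_nf
  · simp [powKernel, hh]

lemma integral_powKernel_mul (hlam : 0 ≤ lam2) (hT : 0 < T) (H H' : ℝ) {S : Set ℝ}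
    (hS : MeasurableSet S) (hS0 : S ⊆ Set.Ioi 0) :
    ∫ h, powKernel lam2 H S h * powKernel lam2 H' S h ∂scaleMeasure T
      = ∫ h in S, covDensity lam2 T (H + H') h := by
  rw [integral_scaleMeasure hT]
  simp_rw [powKernel_mul hlam T H H' hS0]
  rw [setIntegral_indicator hS, Set.inter_eq_right.2 hS0]

lemma integral_powKernel_sq (hlam : 0 ≤ lam2) (hT : 0 < T) (H : ℝ) {S : Set ℝ}
    (hS : MeasurableSet S) (hS0 : S ⊆ Set.Ioi 0) :
    ∫ h, powKernel lam2 H S h ^ 2 ∂scaleMeasure T = ∫ h in S, covDensity lam2 T (2 * H) h := by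
  rw [two_mul, ← integral_powKernel_mul hlam hT H H hS hS0]
  simp_rw [pow_two]

lemma memLp_powKernel (hlam : 0 ≤ lam2) (hT : 0 < T) {H : ℝ} {S : Set ℝ} (hS : MeasurableSet S)
    (hS0 : S ⊆ Set.Ioi 0) (hi : IntegrableOn (covDensity lam2 T (2 * H)) S) :
    MemLp (powKernel lam2 H S) 2 (scaleMeasure T) := by
  rw [memLp_two_iff_integrable_sq (measurable_powKernel lam2 H hS).aestronglyMeasurable,
    scaleMeasure, integrable_withDensity_iff_integrable_smul' (by fun_prop)
      (.of_forall fun _ => ENNReal.ofReal_lt_top)]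
  have e : Set.EqOn (fun h => (ENNReal.ofReal (min h T)).toReal • powKernel lam2 H S h ^ 2)
      (S.indicator (covDensity lam2 T (2 * H))) (Set.Ioi 0) := by
    intro h hh
    simp only [smul_eq_mul]
    rw [ENNReal.toReal_ofReal (le_min (le_of_lt hh) hT.le), pow_two, powKernel_mul hlam T H H hS0,
      two_mul]
  change IntegrableOn _ _ _
  rw [integrableOn_congr_fun e measurableSet_Ioi, IntegrableOn, integrable_indicator_iff hS,
    IntegrableOn, Measure.restrict_restrict hS, Set.inter_eq_left.2 hS0]
  exact hi

lemma trunc_powKernel (lam2 H ε ℓ : ℝ) :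
    trunc ε (powKernel lam2 H (Set.Ioi ℓ)) = powKernel lam2 H (Set.Ioi (max ε ℓ)) := by
  rw [trunc, powKernel, Set.indicator_indicator, Set.Ioi_inter_Ioi]
  rfl

/-- Uniformly in `H ≤ 1 / 4` and in the cut-off `ℓ`, the variances of the power kernels are at most
of the order of those for the critical density `lam2 * h ^ (-2)`. -/
lemma scaleBound_powKernel (hlam : 0 ≤ lam2) (hT : 0 < T) {H ℓ : ℝ} (hH : 0 ≤ H)
    (hH' : H ≤ 1 / 4) (hℓ : 0 ≤ ℓ) (hpos : 0 < H ∨ 0 < ℓ) :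
    ScaleBound lam2 T (lam2 * (1 + 2 * T)) (powKernel lam2 H (Set.Ioi ℓ)) := by
  have hS0 : Set.Ioi ℓ ⊆ Set.Ioi 0 := Set.Ioi_subset_Ioi hℓ
  refine ⟨memLp_powKernel hlam hT measurableSet_Ioi hS0 ?_, fun n => ?_, fun n => ?_⟩
  · rcases hpos with h | h
    · exact (integrableOn_covDensity_zero hlam hT (by linarith) (by linarith)).mono_set hS0
    · exact integrableOn_covDensity_of_pos hlam hT (by linarith) (by linarith) h
  · have hε : (0 : ℝ) < 2⁻¹ ^ n := by positivity
    have hε1 : (2⁻¹ : ℝ) ^ n ≤ 1 := pow_le_one₀ (by norm_num) (by norm_num)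
    obtain ⟨hi, hv⟩ := integrableOn_covMajorant (T := T) hε hε1
    rw [trunc_powKernel, integral_powKernel_sq hlam hT H measurableSet_Ioi
      (Set.Ioi_subset_Ioi (hℓ.trans (le_max_right _ _)))]
    have hi' := integrableOn_covDensity_of_pos hlam hT (s := 2 * H) (by linarith) (by linarith) hε
    calc _ ≤ ∫ h in Set.Ioi (2⁻¹ ^ n), covDensity lam2 T (2 * H) h :=
          setIntegral_mono_set hi' ((ae_restrict_mem measurableSet_Ioi).mono fun h hh =>
            covDensity_nonneg hlam hT _ (hε.trans hh))
            (Set.Ioi_subset_Ioi (le_max_left _ _)).eventuallyLE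
      _ ≤ ∫ h in Set.Ioi (2⁻¹ ^ n), lam2 * covMajorant T h :=
          setIntegral_mono_on hi' (hi.const_mul lam2) measurableSet_Ioi fun h hh =>
            covDensity_le_covMajorant hlam hT (by linarith) (by linarith) (hε.trans hh)
      _ = lam2 * (n * Real.log 2) + lam2 * (2 * T) := by
          rw [integral_const_mul, hv, ← inv_pow, inv_inv, Real.log_pow]
          ring
      _ ≤ _ := by nlinarith
  · have hε : (0 : ℝ) < 2⁻¹ ^ (n + 1) := by positivity
    have hle : (2⁻¹ : ℝ) ^ (n + 1) ≤ 2⁻¹ ^ n :=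
      pow_le_pow_of_le_one (by norm_num) (by norm_num) (Nat.le_succ n)
    have hε1 : (2⁻¹ : ℝ) ^ n ≤ 1 := pow_le_one₀ (by norm_num) (by norm_num)
    rw [powKernel, Set.indicator_indicator]
    have hSm : MeasurableSet (Set.Ioc ((2⁻¹ : ℝ) ^ (n + 1)) (2⁻¹ ^ n) ∩ Set.Ioi ℓ) :=
      measurableSet_Ioc.inter measurableSet_Ioi
    have hsub : Set.Ioc ((2⁻¹ : ℝ) ^ (n + 1)) (2⁻¹ ^ n) ∩ Set.Ioi ℓ ⊆ Set.Ioc (2⁻¹ ^ (n + 1)) (2⁻¹ ^ n) :=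
      Set.inter_subset_left
    have hi' : IntegrableOn (covDensity lam2 T (2 * H)) (Set.Ioc (2⁻¹ ^ (n + 1)) (2⁻¹ ^ n)) :=
      (integrableOn_covDensity_of_pos hlam hT (by linarith) (by linarith) hε).mono_set
        Set.Ioc_subset_Ioi_self
    have key := integral_powKernel_sq hlam hT H hSm (Set.inter_subset_right.trans hS0)
    rw [powKernel] at key
    rw [key]
    calc _ ≤ ∫ h in Set.Ioc ((2⁻¹ : ℝ) ^ (n + 1)) (2⁻¹ ^ n), covDensity lam2 T (2 * H) h :=
          setIntegral_mono_set hi' ((ae_restrict_mem measurableSet_Ioc).mono fun h hh =>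
            covDensity_nonneg hlam hT _ (hε.trans hh.1)) hsub.eventuallyLE
      _ ≤ ∫ h in Set.Ioc ((2⁻¹ : ℝ) ^ (n + 1)) (2⁻¹ ^ n), lam2 * 2 ^ (n + 1) := by
          refine setIntegral_mono_on hi' continuous_const.integrableOn_Ioc measurableSet_Ioc fun h hh => ?_
          refine (covDensity_le_covMajorant hlam hT (by linarith) (by linarith)
            (hε.trans hh.1)).trans (mul_le_mul_of_nonneg_left ?_ hlam)
          rw [covMajorant, if_pos (hh.2.trans hε1), ← inv_inv ((2 : ℝ) ^ (n + 1)), ← inv_pow]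
          exact inv_anti₀ hε hh.1.le
      _ = lam2 := by
          rw [setIntegral_const, Real.volume_real_Ioc_of_le hle, pow_succ, pow_succ, inv_pow,
            smul_eq_mul]
          field_simp
          ring
      _ ≤ _ := by nlinarith

/-- Above a fixed scale, the S-fBM fields converge to the field with `H = 0`. -/
lemma tendsto_expDist_powKernel (hlam : 0 ≤ lam2) (hT : 0 < T) {ε ℓ : ℝ} (hℓ : 0 < ℓ)
    (hℓε : ℓ ≤ ε) :
    Tendsto (fun H => expDist T (trunc ε (powKernel lam2 H (Set.Ioi 0)))
      (trunc ε (powKernel lam2 0 (Set.Ioi ℓ)))) (𝓝[>] 0) (𝓝 0) := by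
  have hε : 0 < ε := hℓ.trans_le hℓε
  have hS0 : Set.Ioi ε ⊆ Set.Ioi 0 := Set.Ioi_subset_Ioi hε.le
  set V : ℝ → ℝ := fun s => ∫ h in Set.Ioi ε, covDensity lam2 T s h with hV
  have hVlim : Tendsto V (𝓝[>] 0) (𝓝 (V 0)) := by
    have h1 : IntegrableOn (covMajorant T) (Set.Ioi ε) :=
      (integrableOn_covMajorant (ε := min ε 1) (by positivity) (min_le_right _ _)).1.mono_set
        (Set.Ioi_subset_Ioi (min_le_left _ _))
    refine tendsto_integral_filter_of_dominated_convergence (fun h => lam2 * covMajorant T h)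
      (.of_forall fun s => (measurable_covDensity _ _ _).aestronglyMeasurable) ?_
      (h1.const_mul lam2) ?_
    · filter_upwards [Ioc_mem_nhdsGT (by norm_num : (0 : ℝ) < 1 / 2)] with s hs
      filter_upwards [ae_restrict_mem measurableSet_Ioi] with h hh
      have hh : 0 < h := hε.trans hh
      rw [Real.norm_eq_abs, abs_of_nonneg (covDensity_nonneg hlam hT s hh)]
      exact covDensity_le_covMajorant hlam hT hs.1.le hs.2 hh
    · filter_upwards [ae_restrict_mem measurableSet_Ioi] with h hh
      have hh : 0 < h := hε.trans hh
      have : Continuous fun s => covDensity lam2 T s h := by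
        unfold covDensity
        exact continuous_const.mul (continuous_const.mul
          (Real.continuous_const_rpow hh.ne' |>.comp (continuous_id.sub continuous_const)))
      exact (this.tendsto 0).mono_left nhdsWithin_le_nhds
  have hdouble : Tendsto (fun H : ℝ => 2 * H) (𝓝[>] 0) (𝓝[>] 0) := by
    refine tendsto_nhdsWithin_iff.2 ⟨?_, ?_⟩
    · have : Tendsto (fun H : ℝ => 2 * H) (𝓝 0) (𝓝 (2 * 0)) := tendsto_id.const_mul 2
      rw [mul_zero] at this
      exact this.mono_left nhdsWithin_le_nhds
    · filter_upwards [self_mem_nhdsWithin] with H hH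
      exact mul_pos two_pos (Set.mem_Ioi.1 hH)
  have e : ∀ H, expDist T (trunc ε (powKernel lam2 H (Set.Ioi 0)))
      (trunc ε (powKernel lam2 0 (Set.Ioi ℓ)))
      = √(Real.exp (V (2 * H)) - 2 * Real.exp (V H) + Real.exp (V 0)) := fun H => by
    rw [trunc_powKernel, trunc_powKernel, max_eq_left hε.le, max_eq_left hℓε, expDist,
      integral_powKernel_sq hlam hT _ measurableSet_Ioi hS0,
      integral_powKernel_sq hlam hT _ measurableSet_Ioi hS0,
      integral_powKernel_mul hlam hT _ _ measurableSet_Ioi hS0, add_zero, mul_zero]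
  simp_rw [e]
  have h1 := (Real.continuous_exp.tendsto _).comp (hVlim.comp hdouble)
  have h2 := (Real.continuous_exp.tendsto _).comp hVlim
  have h3 := (Real.continuous_sqrt.tendsto _).comp
    ((h1.sub (h2.const_mul 2)).add_const (Real.exp (V 0)))
  rwa [show ∀ x : ℝ, x - 2 * x + x = 0 from fun x => by ring, Real.sqrt_zero] at h3

lemma expDist_self (T : ℝ) (g : ℝ → ℝ) : expDist T g g = 0 := by
  rw [expDist]
  simp_rw [pow_two]
  rw [show ∀ x : ℝ, x - 2 * x + x = 0 from fun x => by ring, Real.sqrt_zero]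

/-! ### From cone processes to exponential fields -/

lemma IsConeProcess.variance_eq {Ω : Type*} [MeasurableSpace Ω] {P : Measure Ω}
    [IsProbabilityMeasure P] {W : (ℝ × ℝ → ℝ) → Ω → ℝ} (hW : IsWhiteNoise W P) {c H ℓ m : ℝ}
    {X : Ω → C(ℝ, ℝ)} (hX : IsConeProcess W P c H ℓ T m X) (hℓ : 0 ≤ ℓ)
    (hg : MemLp (powKernel c H (Set.Ioi ℓ)) 2 (scaleMeasure T)) :
    Var[fun a => X a 0; P] = ∫ h, powKernel c H (Set.Ioi ℓ) h ^ 2 ∂scaleMeasure T := by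
  have h0 : (fun a => X a 0) =ᵐ[P] fun a => m + W (kern T (powKernel c H (Set.Ioi ℓ)) 0) a := by
    filter_upwards [hX 0] with a ha
    rw [ha, coneKernel_eq_kern c H T 0 hℓ]
    rfl
  rw [variance_congr h0, variance_const_add (hW.aemeasurable (memLp_kern hg 0)).aestronglyMeasurable,
    hW.variance_eq (memLp_kern hg 0), integral_kern_sq hg]

/-- Fixing `E[e^X] = sigma2` amounts to normalising the exponential of the Wiener integral. -/
lemma IsConeProcess.isExpField {Ω : Type*} [MeasurableSpace Ω] {P : Measure Ω}
    [IsProbabilityMeasure P] {W : (ℝ × ℝ → ℝ) → Ω → ℝ} (hW : IsWhiteNoise W P)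
    {c H ℓ m sigma2 : ℝ} {X : Ω → C(ℝ, ℝ)} (hX : IsConeProcess W P c H ℓ T m X) (hℓ : 0 ≤ ℓ)
    (hg : MemLp (powKernel c H (Set.Ioi ℓ)) 2 (scaleMeasure T))
    (hm : Real.exp (m + Var[fun a => X a 0; P] / 2) = sigma2) :
    IsExpField W P T sigma2 (powKernel c H (Set.Ioi ℓ)) X := by
  refine ⟨hg, fun t => ?_⟩
  filter_upwards [hX t] with a ha
  rw [hX.variance_eq hW hℓ hg] at hm
  rw [ha, coneKernel_eq_kern c H T t hℓ, wickExp, ← hm, integral_kern_sq hg, ← Real.exp_add,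
    powKernel]
  ring_nf

end PowKernel

/-! ### Convergence in `L^p` of the integrals -/

/-- A family of fields whose scales above each fixed `2 ^ (-n)` converge to those of the field with
scale density `lam2 * h ^ (-2)`, within the uniform class `ScaleBound`. -/
structure IsRegularization {Ω ι : Type*} [MeasurableSpace Ω] (W : (ℝ × ℝ → ℝ) → Ω → ℝ)
    (P : Measure Ω) (lam2 T sigma2 c : ℝ) (l : Filter ι) (g : ι → ℝ → ℝ)
    (X : ι → Ω → C(ℝ, ℝ)) : Prop where
  scaleBound : ∀ᶠ i in l, ScaleBound lam2 T c (g i)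
  isExpField : ∀ i, IsExpField W P T sigma2 (g i) (X i)
  tendsto : ∀ n : ℕ, Tendsto (fun i => expDist T (trunc (2⁻¹ ^ n) (g i))
    (powKernel lam2 0 (Set.Ioi (2⁻¹ ^ n)))) l (𝓝 0)

section Convergence

variable {Ω : Type*} [MeasurableSpace Ω] {P : Measure Ω} {W : (ℝ × ℝ → ℝ) → Ω → ℝ}
  {lam2 T sigma2 : ℝ} {A B : ℝ} {f : ℝ → ℝ} {C : ℝ}

/-- The cut-off fields form a regularization. -/
lemma isRegularization_cutoff (hlam : 0 ≤ lam2) (hT : 0 < T) {ι : Type*} {l : Filter ι}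
    {ℓ : ι → ℝ} (hℓ : ∀ i, 0 < ℓ i) (hℓl : Tendsto ℓ l (𝓝 0)) {X : ι → Ω → C(ℝ, ℝ)}
    (hX : ∀ i, IsExpField W P T sigma2 (powKernel lam2 0 (Set.Ioi (ℓ i))) (X i)) :
    IsRegularization W P lam2 T sigma2 (lam2 * (1 + 2 * T)) l
      (fun i => powKernel lam2 0 (Set.Ioi (ℓ i))) X := by
  refine ⟨.of_forall fun i => scaleBound_powKernel hlam hT le_rfl (by norm_num) (hℓ i).le
    (Or.inr (hℓ i)), hX, fun n => tendsto_const_nhds.congr' ?_⟩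
  filter_upwards [hℓl.eventually (gt_mem_nhds (by positivity : (0 : ℝ) < 2⁻¹ ^ n))] with i hi
  rw [trunc_powKernel, max_eq_left hi.le, expDist_self]

/-- The S-fBM fields form a regularization as `H → 0`. -/
lemma isRegularization_sfbm (hlam : 0 ≤ lam2) (hT : 0 < T) {ι : Type*} {l : Filter ι}
    {H : ι → ℝ} (hHl : Tendsto H l (𝓝[>] 0)) {X : ι → Ω → C(ℝ, ℝ)}
    (hX : ∀ i, IsExpField W P T sigma2 (powKernel lam2 (H i) (Set.Ioi 0)) (X i)) :
    IsRegularization W P lam2 T sigma2 (lam2 * (1 + 2 * T)) l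
      (fun i => powKernel lam2 (H i) (Set.Ioi 0)) X := by
  refine ⟨?_, hX, fun n => ?_⟩
  · filter_upwards [hHl.eventually (Ioc_mem_nhdsGT (by norm_num : (0 : ℝ) < 1 / 4))] with i hi
    exact scaleBound_powKernel hlam hT hi.1.le hi.2 le_rfl (Or.inl hi.1)
  · have h := tendsto_expDist_powKernel hlam hT (ε := 2⁻¹ ^ n) (ℓ := 2⁻¹ ^ n) (by positivity) le_rfl
    simp_rw [trunc_powKernel lam2 0, max_self] at h
    exact h.comp hHl

variable [IsProbabilityMeasure P]

/-- The integrals against a regularization are close to those against the cut-off fields, for all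
small enough cut-offs `2 ^ (-m)`. -/
lemma IsRegularization.eventually_eLpNorm_sub_le (hW : IsWhiteNoise W P) (hlam : 0 ≤ lam2)
    (hT : 0 < T) (hs : 0 ≤ sigma2) {Y : ℕ → Ω → C(ℝ, ℝ)}
    (hY : ∀ m : ℕ, IsExpField W P T sigma2 (powKernel lam2 0 (Set.Ioi (2⁻¹ ^ m))) (Y m)) {p : ℝ}
    (hp : 1 < p) (hp' : p ≤ 2) (hplam : p * lam2 < 2) (hAB : A ≤ B) (hfc : Continuous f)
    (hf : ∀ t, |f t| ≤ C) {ι : Type*} {l : Filter ι} {g : ι → ℝ → ℝ} {X : ι → Ω → C(ℝ, ℝ)}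
    (hX : IsRegularization W P lam2 T sigma2 (lam2 * (1 + 2 * T)) l g X) {ε : ℝ} (hε : 0 < ε) :
    ∃ n : ℕ, ∀ᶠ i in l, ∀ m ≥ n, eLpNorm (pathIntegral A B f (X i) - pathIntegral A B f (Y m))
      (ENNReal.ofReal p) P ≤ ENNReal.ofReal ε := by
  obtain ⟨K, s, hK, hs0, hs1, H⟩ := hW.exists_eLpNorm_pathIntegral_sub_le (T := T)
    (c := lam2 * (1 + 2 * T)) hp hp' hplam hs hAB C
  have h1 : Tendsto (fun n : ℕ => sigma2 * (2 * (K * s ^ n))) atTop (𝓝 0) := by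
    have := (((tendsto_pow_atTop_nhds_zero_of_lt_one hs0.le hs1).const_mul K).const_mul 2).const_mul
      sigma2
    simpa using this
  obtain ⟨n, hn⟩ := (h1.eventually (gt_mem_nhds (half_pos hε))).exists
  refine ⟨n, ?_⟩
  have h2 : Tendsto (fun i => sigma2 * (C * (B - A) * expDist T (trunc (2⁻¹ ^ n) (g i))
      (powKernel lam2 0 (Set.Ioi (2⁻¹ ^ n))))) l (𝓝 0) := by
    have := ((hX.tendsto n).const_mul (C * (B - A))).const_mul sigma2
    simpa using this
  filter_upwards [hX.scaleBound, h2.eventually (gt_mem_nhds (half_pos hε))] with i hi hi2 m hm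
  have hmn : (2⁻¹ : ℝ) ^ m ≤ 2⁻¹ ^ n := pow_le_pow_of_le_one (by norm_num) (by norm_num) hm
  have hb := H f hfc hf (g i) _ (X i) (Y m) hi (scaleBound_powKernel hlam hT le_rfl (by norm_num)
    (by positivity) (Or.inr (by positivity))) (hX.isExpField i) (hY m) n
  rw [trunc_powKernel lam2 0, max_eq_left hmn] at hb
  refine hb.trans (ENNReal.ofReal_le_ofReal ?_)
  rw [mul_add]
  linarith

/-- The integrals of `f` against all regularizations have a common limit in `L^p`. -/
lemma exists_tendsto_eLpNorm_pathIntegral (hW : IsWhiteNoise W P) (hlam : 0 ≤ lam2)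
    (hT : 0 < T) (hs : 0 ≤ sigma2) {Y : ℕ → Ω → C(ℝ, ℝ)}
    (hY : ∀ m : ℕ, IsExpField W P T sigma2 (powKernel lam2 0 (Set.Ioi (2⁻¹ ^ m))) (Y m)) {p : ℝ}
    (hp : 1 < p) (hp' : p ≤ 2) (hplam : p * lam2 < 2) (hAB : A ≤ B) (hfc : Continuous f)
    (hf : ∀ t, |f t| ≤ C) :
    ∃ L : Ω → ℝ, AEStronglyMeasurable L P ∧
      ∀ {ι : Type} {l : Filter ι} {g : ι → ℝ → ℝ} {X : ι → Ω → C(ℝ, ℝ)},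
      IsRegularization W P lam2 T sigma2 (lam2 * (1 + 2 * T)) l g X →
      Tendsto (fun i => eLpNorm (pathIntegral A B f (X i) - L) (ENNReal.ofReal p) P) l (𝓝 0) := by
  have hq1 : 1 ≤ ENNReal.ofReal p := by
    rw [← ENNReal.ofReal_one]; exact ENNReal.ofReal_le_ofReal hp.le
  have hq2 : ENNReal.ofReal p ≤ 2 := by
    rw [← ENNReal.ofReal_ofNat]; exact ENNReal.ofReal_le_ofReal hp'
  have : Fact (1 ≤ ENNReal.ofReal p) := ⟨hq1⟩
  have hmem : ∀ m, MemLp (pathIntegral A B f (Y m)) (ENNReal.ofReal p) P := fun m =>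
    ((hY m).memLp_pathIntegral hW hs hAB hfc hf).mono_exponent hq2
  have hYreg := isRegularization_cutoff hlam hT (l := atTop) (fun m => by positivity)
    (tendsto_pow_atTop_nhds_zero_of_lt_one (r := (2⁻¹ : ℝ)) (by norm_num) (by norm_num)) hY
  have hcau : CauchySeq fun m => (hmem m).toLp := by
    rw [EMetric.cauchySeq_iff]
    intro ε hε
    obtain ⟨δ, hδ, hδε⟩ := ENNReal.lt_iff_exists_real_btwn.1 hε
    have hδ0 : 0 < δ := ENNReal.ofReal_pos.1 hδε.1
    obtain ⟨n, hn⟩ := hYreg.eventually_eLpNorm_sub_le hW hlam hT hs hY hp hp' hplam hAB hfc hf hδ0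
    obtain ⟨n', hn'⟩ := eventually_atTop.1 hn
    refine ⟨max n n', fun i hi m hm => ?_⟩
    rw [Lp.edist_toLp_toLp]
    exact (hn' i ((le_max_right _ _).trans hi) m ((le_max_left _ _).trans hm)).trans_lt hδε.2
  obtain ⟨L₀, hL⟩ := cauchySeq_tendsto_of_complete hcau
  let L : Ω → ℝ := L₀
  have hL' : Tendsto (fun m => eLpNorm (pathIntegral A B f (Y m) - L) (ENNReal.ofReal p) P) atTop
      (𝓝 0) := by
    rw [tendsto_iff_edist_tendsto_0] at hL
    refine hL.congr fun m => ?_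
    rw [Lp.edist_def]
    exact eLpNorm_congr_ae ((hmem m).coeFn_toLp.sub .rfl)
  refine ⟨L, (Lp.memLp L₀).aestronglyMeasurable, fun {ι l g X} hX => ?_⟩
  rw [ENNReal.tendsto_nhds_zero]
  intro ε hε
  obtain ⟨δ, hδ, hδε⟩ := ENNReal.lt_iff_exists_real_btwn.1 hε
  have hδ0 : 0 < δ := ENNReal.ofReal_pos.1 hδε.1
  obtain ⟨n, hn⟩ := hX.eventually_eLpNorm_sub_le hW hlam hT hs hY hp hp' hplam hAB hfc hf
    (half_pos hδ0)
  obtain ⟨m, hm, hmn⟩ := ((hL'.eventually (ge_mem_nhds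
    (ENNReal.ofReal_pos.2 (half_pos hδ0)))).and (eventually_ge_atTop n)).exists
  filter_upwards [hn] with i hi
  have hXm := (hX.isExpField i).aestronglyMeasurable_pathIntegral hW hAB hfc
  calc eLpNorm (pathIntegral A B f (X i) - L) (ENNReal.ofReal p) P
      = eLpNorm ((pathIntegral A B f (X i) - pathIntegral A B f (Y m))
          + (pathIntegral A B f (Y m) - L)) (ENNReal.ofReal p) P := by
        rw [sub_add_sub_cancel]
    _ ≤ ENNReal.ofReal (δ / 2) + ENNReal.ofReal (δ / 2) :=
        (eLpNorm_add_le (hXm.sub (hmem m).1) ((hmem m).1.sub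
          (Lp.memLp L₀).aestronglyMeasurable) hq1).trans (add_le_add (hi m hmn) hm)
    _ = ENNReal.ofReal δ := by
        rw [← ENNReal.ofReal_add (half_pos hδ0).le (half_pos hδ0).le, add_halves]
    _ ≤ ε := hδε.2.le

end Convergence

/-! ### The vague topology -/

instance (μ : LocFinMeasure) : IsLocallyFiniteMeasure μ.1 := μ.2

lemma integrable_locFinMeasure (μ : LocFinMeasure) (f : C_c(ℝ, ℝ)) : Integrable f μ.1 :=
  f.continuous.integrable_of_hasCompactSupport f.hasCompactSupport

/-- The trapezoidal function equal to `1` on `[a, b]` and to `0` at distance at least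
`1 / (k + 1)` from `[a, b]`. -/
def trapezoid (a b : ℝ) (k : ℕ) : C_c(ℝ, ℝ) where
  toFun x := max 0 (1 - (k + 1) * max 0 (max (a - x) (x - b)))
  continuous_toFun := by fun_prop
  hasCompactSupport' := by
    refine HasCompactSupport.intro (isCompact_Icc (a := a - 1) (b := b + 1)) fun x hx => ?_
    refine max_eq_left (sub_nonpos.2 ?_)
    have h1 : 1 ≤ max 0 (max (a - x) (x - b)) := by
      rw [Set.mem_Icc, not_and_or, not_le, not_le] at hx
      rcases hx with h | h
      · exact le_max_of_le_right (le_max_of_le_left (by linarith))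
      · exact le_max_of_le_right (le_max_of_le_right (by linarith))
    nlinarith [k.cast_nonneg (α := ℝ)]

section trapezoid

variable {a b x : ℝ} {k : ℕ}

lemma trapezoid_nonneg : 0 ≤ trapezoid a b k x := le_max_left _ _

lemma trapezoid_le_one : trapezoid a b k x ≤ 1 :=
  max_le zero_le_one (sub_le_self _ (by positivity))

lemma trapezoid_eq_one (hx : x ∈ Set.Icc a b) : trapezoid a b k x = 1 := by
  change max 0 (1 - ((k : ℝ) + 1) * max 0 (max (a - x) (x - b))) = 1
  rw [max_eq_left (max_le (sub_nonpos.2 hx.1) (sub_nonpos.2 hx.2)), mul_zero, sub_zero,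
    max_eq_right zero_le_one]

lemma trapezoid_eq_zero (hx : x ∉ Set.Icc (a - 1 / (k + 1)) (b + 1 / (k + 1))) :
    trapezoid a b k x = 0 := by
  refine max_eq_left (sub_nonpos.2 ?_)
  have hk : (0 : ℝ) < k + 1 := by positivity
  rw [← div_le_iff₀' hk]
  rw [Set.mem_Icc, not_and_or, not_le, not_le] at hx
  rcases hx with h | h
  · exact le_max_of_le_right (le_max_of_le_left (by linarith))
  · exact le_max_of_le_right (le_max_of_le_right (by linarith))

end trapezoid

/-- The trapezoidal function equal to `1` on `[-k, k]` and to `0` off `[-(k + 1), k + 1]`. -/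
def bump (k : ℕ) : C_c(ℝ, ℝ) := trapezoid (-k) k 0

lemma bump_nonneg (k : ℕ) (x : ℝ) : 0 ≤ bump k x := trapezoid_nonneg

lemma bump_eq_one {k : ℕ} {x : ℝ} (hx : |x| ≤ k) : bump k x = 1 := trapezoid_eq_one (abs_le.1 hx)

lemma bump_eq_zero {k : ℕ} {x : ℝ} (hx : k + 1 < |x|) : bump k x = 0 := by
  refine trapezoid_eq_zero fun h => not_le.2 hx (abs_le.2 ?_)
  simp only [CharP.cast_eq_zero, zero_add, div_one] at h
  exact ⟨by linarith [h.1], h.2⟩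

/-- A countable family of compactly supported functions whose integrals determine the vague
topology: the functions `bump k`, and their products with a dense sequence of `C(ℝ, ℝ)`. -/
def testFun (t : ℕ × Option ℕ) : C_c(ℝ, ℝ) :=
  t.2.elim (bump t.1) fun j => TopologicalSpace.denseSeq C(ℝ, ℝ) j • bump t.1

lemma exists_testFun_approx (f : C_c(ℝ, ℝ)) : ∃ k : ℕ, ∀ ε > 0, ∃ j : ℕ, ∀ x,
    |f x - testFun (k, some j) x| ≤ ε * bump k x := by
  obtain ⟨R, hR⟩ := f.hasCompactSupport.isCompact.isBounded.subset_closedBall 0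
  refine ⟨⌈R⌉₊, fun ε hε => ?_⟩
  have h := Metric.tendstoUniformlyOn_iff.1
    (ContinuousMap.tendsto_iff_forall_isCompact_tendstoUniformlyOn.1
      (tendsto_id (α := C(ℝ, ℝ)) (x := 𝓝 f.toContinuousMap)) _
      (isCompact_Icc (a := -((⌈R⌉₊ : ℝ) + 1)) (b := ⌈R⌉₊ + 1))) ε hε
  obtain ⟨j, hj⟩ := (TopologicalSpace.denseRange_denseSeq C(ℝ, ℝ)).mem_nhds h
  refine ⟨j, fun x => ?_⟩
  change |f x - TopologicalSpace.denseSeq C(ℝ, ℝ) j x * bump ⌈R⌉₊ x| ≤ _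
  have hfx : f x = f x * bump ⌈R⌉₊ x := by
    rcases le_or_gt |x| (⌈R⌉₊ : ℝ) with hx | hx
    · rw [bump_eq_one hx, mul_one]
    · suffices f x = 0 by rw [this, zero_mul]
      refine image_eq_zero_of_notMem_tsupport fun hx' => ?_
      have := hR hx'
      rw [mem_closedBall_zero_iff, Real.norm_eq_abs] at this
      exact absurd (this.trans (Nat.le_ceil R)) (not_le.2 hx)
  rw [hfx, ← sub_mul, abs_mul, abs_of_nonneg (bump_nonneg _ x)]
  rcases le_or_gt |x| ((⌈R⌉₊ : ℝ) + 1) with hx | hx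
  · exact mul_le_mul_of_nonneg_right (hj x (abs_le.1 hx)).le (bump_nonneg _ x)
  · rw [bump_eq_zero hx, mul_zero, mul_zero]

lemma testFun_eq_zero {t : ℕ × Option ℕ} {x : ℝ} (hx : x ∉ Set.Icc (-((t.1 : ℝ) + 1)) (t.1 + 1)) :
    testFun t x = 0 := by
  have h : bump t.1 x = 0 := bump_eq_zero (by rwa [Set.mem_Icc, ← abs_le, not_le] at hx)
  rcases t with ⟨k, _ | j⟩
  · exact h
  · change _ * bump k x = 0
    rw [h, mul_zero]

/-- Two families of measures which are asymptotically equal on the test family, one of them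
having bounded mass on compact sets, are asymptotically equal on all of `C_c(ℝ, ℝ)`. -/
lemma tendsto_integral_sub_of_testFun {ι : Type*} {l : Filter ι} {μ ν : ι → LocFinMeasure}
    (h : ∀ t, Tendsto (fun i => ∫ x, testFun t x ∂(μ i).1 - ∫ x, testFun t x ∂(ν i).1) l (𝓝 0))
    (hν : ∀ k, ∃ C, ∀ᶠ i in l, ∫ x, bump k x ∂(ν i).1 ≤ C) (f : C_c(ℝ, ℝ)) :
    Tendsto (fun i => ∫ x, f x ∂(μ i).1 - ∫ x, f x ∂(ν i).1) l (𝓝 0) := by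
  obtain ⟨k, hk⟩ := exists_testFun_approx f
  obtain ⟨C, hC⟩ := hν k
  rw [Metric.tendsto_nhds]
  intro ε hε
  -- the error is at most `δ * (∫ bump dμ + ∫ bump dν) ≤ δ * (2 * C + 1)`, up to a term `ε / 2`
  set δ := ε / 2 / (2 * |C| + 1)
  have hδ : 0 < δ := by positivity
  obtain ⟨j, hj⟩ := hk δ hδ
  have key : ∀ m : LocFinMeasure,
      |∫ x, f x ∂m.1 - ∫ x, testFun (k, some j) x ∂m.1| ≤ δ * ∫ x, bump k x ∂m.1 := fun m => by
    rw [← integral_sub (integrable_locFinMeasure m f) (integrable_locFinMeasure m _),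
      ← integral_const_mul]
    exact norm_integral_le_of_norm_le (f := fun x => f x - testFun (k, some j) x)
      ((integrable_locFinMeasure m _).const_mul δ) (.of_forall hj)
  filter_upwards [Metric.tendsto_nhds.1 (h (k, some j)) (ε / 2) (by positivity),
    Metric.tendsto_nhds.1 (h (k, none)) 1 one_pos, hC] with i h1 h2 h3
  rw [Real.dist_eq, sub_zero] at h1 h2 ⊢
  change |∫ x, bump k x ∂(μ i).1 - ∫ x, bump k x ∂(ν i).1| < 1 at h2
  have h4 := key (μ i)
  have h5 := key (ν i)
  have h6 : δ * ∫ x, bump k x ∂(μ i).1 + δ * ∫ x, bump k x ∂(ν i).1 ≤ ε / 2 := by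
    rw [← mul_add, ← div_mul_cancel₀ (ε / 2) (by positivity : 2 * |C| + 1 ≠ 0)]
    refine mul_le_mul_of_nonneg_left ?_ hδ.le
    linarith [(abs_lt.1 h2).2, le_abs_self C]
  rw [abs_le] at h4 h5
  rw [abs_lt] at h1 ⊢
  constructor <;> linarith [h1.1, h1.2, h4.1, h4.2, h5.1, h5.2]

lemma tendsto_locFinMeasure_iff {ι : Type*} {l : Filter ι} {μ : ι → LocFinMeasure}
    {ν : LocFinMeasure} : Tendsto μ l (𝓝 ν) ↔
      ∀ f : C_c(ℝ, ℝ), Tendsto (fun i => ∫ x, f x ∂(μ i).1) l (𝓝 (∫ x, f x ∂ν.1)) := by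
  simp only [nhds_iInf, tendsto_iInf, nhds_induced, tendsto_comap_iff, Function.comp_def]

/-- The test family determines the vague topology. -/
lemma tendsto_locFinMeasure_iff_testFun {ι : Type*} {l : Filter ι} {μ : ι → LocFinMeasure}
    {ν : LocFinMeasure} : Tendsto μ l (𝓝 ν) ↔
      ∀ t, Tendsto (fun i => ∫ x, testFun t x ∂(μ i).1) l (𝓝 (∫ x, testFun t x ∂ν.1)) := by
  rw [tendsto_locFinMeasure_iff]
  refine ⟨fun h t => h _, fun h f => tendsto_sub_nhds_zero_iff.1 ?_⟩
  exact tendsto_integral_sub_of_testFun (ν := fun _ => ν)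
    (fun t => tendsto_sub_nhds_zero_iff.2 (h t)) (fun k => ⟨_, .of_forall fun _ => le_rfl⟩) f

/-- A sequence of measures whose integrals against the test family converge has a vague limit. -/
lemma exists_tendsto_locFinMeasure {μ : ℕ → LocFinMeasure} {L : ℕ × Option ℕ → ℝ}
    (h : ∀ t, Tendsto (fun n => ∫ x, testFun t x ∂(μ n).1) atTop (𝓝 (L t))) :
    ∃ ν : LocFinMeasure, Tendsto μ atTop (𝓝 ν) := by
  have hc : ∀ f : C_c(ℝ, ℝ), ∃ a, Tendsto (fun n => ∫ x, f x ∂(μ n).1) atTop (𝓝 a) := fun f => by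
    refine cauchySeq_tendsto_of_complete (cauchySeq_iff_tendsto_dist_atTop_0.2 ?_)
    rw [← prod_atTop_atTop_eq]
    have h1 : Tendsto (Prod.fst : ℕ × ℕ → ℕ) (atTop ×ˢ atTop) atTop := tendsto_fst
    have h2 : Tendsto (Prod.snd : ℕ × ℕ → ℕ) (atTop ×ˢ atTop) atTop := tendsto_snd
    refine tendsto_zero_iff_norm_tendsto_zero.1 (tendsto_integral_sub_of_testFun
      (μ := fun i : ℕ × ℕ => μ i.1) (ν := fun i : ℕ × ℕ => μ i.2) (fun t => ?_) (fun k => ?_) f)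
    · simpa using ((h t).comp h1).sub ((h t).comp h2)
    · refine ⟨L (k, none) + 1, ?_⟩
      exact ((h (k, none)).comp h2).eventually (Iic_mem_nhds (lt_add_one _))
  choose Λ hΛ using hc
  let Λ' : C_c(ℝ, ℝ) →ₗ[ℝ] ℝ :=
    { toFun := Λ
      map_add' := fun f g => tendsto_nhds_unique (hΛ (f + g)) <| ((hΛ f).add (hΛ g)).congr
        fun n => (integral_add (integrable_locFinMeasure _ f) (integrable_locFinMeasure _ g)).symm
      map_smul' := fun c f => tendsto_nhds_unique (hΛ (c • f)) <| ((hΛ f).const_mul c).congr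
        fun n => (integral_const_mul c _).symm }
  let Λp := PositiveLinearMap.mk₀ Λ' fun f hf =>
    ge_of_tendsto' (hΛ f) fun n => integral_nonneg (CompactlySupportedContinuousMap.le_def.1 hf)
  refine ⟨⟨RealRMK.rieszMeasure Λp, inferInstance⟩, tendsto_locFinMeasure_iff.2 fun f => ?_⟩
  rw [RealRMK.integral_rieszMeasure]
  exact hΛ f

lemma isInducing_integral_testFun :
    IsInducing fun (μ : LocFinMeasure) t => ∫ x, testFun t x ∂μ.1 := by
  refine isInducing_iff_nhds.2 fun ν => le_antisymm ?_ ?_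
  · exact tendsto_iff_comap.1 (tendsto_pi_nhds.2 (tendsto_locFinMeasure_iff_testFun.1 tendsto_id))
  · exact (tendsto_locFinMeasure_iff_testFun (μ := id)).2 (tendsto_pi_nhds.1 tendsto_comap)

/-- A random locally finite measure is measurable, up to a null set, as soon as its integrals
against the test family are. -/
lemma aemeasurable_locFinMeasure {Ω : Type*} [MeasurableSpace Ω] {P : Measure Ω}
    {M : Ω → LocFinMeasure} (h : ∀ t, AEMeasurable (fun a => ∫ x, testFun t x ∂(M a).1) P) :
    AEMeasurable M P := by
  rcases isEmpty_or_nonempty Ω with _ | ⟨⟨a₀⟩⟩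
  · exact Subsingleton.measurable.aemeasurable
  set Φ := fun (μ : LocFinMeasure) t => ∫ x, testFun t x ∂μ.1
  have hΦ : borel LocFinMeasure = MeasurableSpace.comap Φ inferInstance := by
    rw [BorelSpace.measurable_eq (α := ℕ × Option ℕ → ℝ), ← borel_comap,
      ← isInducing_integral_testFun.eq_induced]
  have h' : AEMeasurable (fun a => Φ (M a)) P := aemeasurable_pi_lambda _ h
  obtain ⟨s, hs, hsm, hs0⟩ := exists_measurable_superset_of_null (ae_iff.1 h'.ae_eq_mk)
  classical
  refine ⟨s.piecewise (fun _ => M a₀) M, ?_, ?_⟩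
  · rw [BorelSpace.measurable_eq (α := LocFinMeasure), hΦ, measurable_comap_iff]
    have : Φ ∘ s.piecewise (fun _ => M a₀) M = s.piecewise (fun _ => Φ (M a₀)) (h'.mk _) := by
      ext1 a
      by_cases ha : a ∈ s
      · simp [ha]
      · have : Φ (M a) = h'.mk _ a := not_not.1 fun h => ha (hs h)
        simp [ha, this]
    rw [this]
    exact measurable_const.piecewise hsm h'.measurable_mk
  · filter_upwards [measure_eq_zero_iff_ae_notMem.1 hs0] with a ha
    simp [ha]

/-! ### Convergence of random measures -/

section RandomMeasure

variable {Ω : Type*} [MeasurableSpace Ω] {P : Measure Ω}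

/-- Countably many sequences converging in measure converge almost everywhere along a common
subsequence. -/
lemma exists_strictMono_forall_ae_tendsto {κ : Type*} [Encodable κ] {Z : κ → ℕ → Ω → ℝ}
    {L : κ → Ω → ℝ} (h : ∀ t, TendstoInMeasure P (Z t) atTop (L t)) :
    ∃ φ : ℕ → ℕ, StrictMono φ ∧
      ∀ᵐ a ∂P, ∀ t, Tendsto (fun n => Z t (φ n) a) atTop (𝓝 (L t a)) := by
  have hn : ∀ n : ℕ, ∀ᶠ k in atTop, ∀ t : κ, Encodable.encode t < n →
      P {a | (2⁻¹ : ENNReal) ^ n ≤ edist (Z t k a) (L t a)} ≤ 2⁻¹ ^ n := fun n => by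
    have hf : {t : κ | Encodable.encode t < n}.Finite :=
      (Set.finite_Iio n).preimage Encodable.encode_injective.injOn
    refine (hf.eventually_all (p := fun t k =>
      P {a | (2⁻¹ : ENNReal) ^ n ≤ edist (Z t k a) (L t a)} ≤ 2⁻¹ ^ n)).2 fun t _ => ?_
    have hp : (0 : ENNReal) < 2⁻¹ ^ n := ENNReal.pow_pos (by simp) n
    exact (h t _ hp).eventually (Iic_mem_nhds hp)
  obtain ⟨φ, hφ, hb⟩ := extraction_forall_of_eventually hn
  refine ⟨φ, hφ, ae_all_iff.2 fun t => ?_⟩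
  set s : ℕ → Set Ω := fun n => if Encodable.encode t < n then
    {a | (2⁻¹ : ENNReal) ^ n ≤ edist (Z t (φ n) a) (L t a)} else ∅
  have hs : ∑' n, P (s n) ≠ ⊤ := by
    refine ne_top_of_le_ne_top (b := ∑' n, (2⁻¹ : ENNReal) ^ n) ?_ (ENNReal.tsum_le_tsum fun n => ?_)
    · rw [ENNReal.tsum_geometric]
      simp
    · by_cases hn : Encodable.encode t < n
      · simpa only [s, if_pos hn] using hb n t hn
      · simp [s, hn]
  filter_upwards [ae_eventually_notMem hs] with a ha
  refine tendsto_iff_edist_tendsto_0.2 (tendsto_of_tendsto_of_tendsto_of_le_of_le'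
    tendsto_const_nhds (ENNReal.tendsto_pow_atTop_nhds_zero_of_lt_one (r := 2⁻¹) (by simp))
    (.of_forall fun _ => zero_le) ?_)
  filter_upwards [ha, eventually_gt_atTop (Encodable.encode t)] with n h1 h2
  simp only [s, if_pos h2, Set.mem_ofPred_eq, not_le] at h1
  exact h1.le

/-- Random measures whose integrals against the test family converge in probability converge in
distribution. -/
lemma tendstoInDistribution_of_testFun [IsProbabilityMeasure P] {ι : Type*} {l : Filter ι}
    [l.IsCountablyGenerated] {N : ι → Ω → LocFinMeasure} {M : Ω → LocFinMeasure}
    (hN : ∀ i, AEMeasurable (N i) P) (hM : AEMeasurable M P)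
    (h : ∀ t, TendstoInMeasure P (fun i a => ∫ x, testFun t x ∂(N i a).1) l
      fun a => ∫ x, testFun t x ∂(M a).1) :
    TendstoInDistribution N l M (fun _ => P) P where
  forall_aemeasurable := hN
  aemeasurable_limit := hM
  tendsto := by
    refine tendsto_of_subseq_tendsto fun ns hns => ?_
    obtain ⟨φ, -, hφ⟩ := exists_strictMono_forall_ae_tendsto
      (Z := fun t n a => ∫ x, testFun t x ∂(N (ns n) a).1) fun t ε hε => (h t ε hε).comp hns
    exact ⟨φ, (tendstoInDistribution_of_ae_tendsto (fun n => hN (ns (φ n))) hM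
      (hφ.mono fun a ha => tendsto_locFinMeasure_iff_testFun.2 ha)).tendsto⟩

/-- If the integrals of random measures against the test family converge in probability, the
limits are the integrals against a random measure. -/
lemma exists_random_locFinMeasure {N : ℕ → Ω → LocFinMeasure} {L : ℕ × Option ℕ → Ω → ℝ}
    (hN : ∀ t n, AEMeasurable (fun a => ∫ x, testFun t x ∂(N n a).1) P)
    (h : ∀ t, TendstoInMeasure P (fun n a => ∫ x, testFun t x ∂(N n a).1) atTop (L t)) :
    ∃ M : Ω → LocFinMeasure, AEMeasurable M P ∧
      ∀ t, (fun a => ∫ x, testFun t x ∂(M a).1) =ᵐ[P] L t := by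
  obtain ⟨φ, -, hφ⟩ := exists_strictMono_forall_ae_tendsto h
  have hM : ∀ a, ∃ ν : LocFinMeasure,
      (∀ t, Tendsto (fun n => ∫ x, testFun t x ∂(N (φ n) a).1) atTop (𝓝 (L t a))) →
      Tendsto (fun n => N (φ n) a) atTop (𝓝 ν) := fun a => by
    by_cases ha : ∀ t, Tendsto (fun n => ∫ x, testFun t x ∂(N (φ n) a).1) atTop (𝓝 (L t a))
    · obtain ⟨ν, hν⟩ := exists_tendsto_locFinMeasure ha
      exact ⟨ν, fun _ => hν⟩
    · exact ⟨N 0 a, fun h => absurd h ha⟩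
  choose M hM using hM
  have hML : ∀ t, (fun a => ∫ x, testFun t x ∂(M a).1) =ᵐ[P] L t := fun t => by
    filter_upwards [hφ] with a ha
    exact tendsto_nhds_unique (tendsto_locFinMeasure_iff_testFun.1 (hM a ha) t) (ha t)
  exact ⟨M, aemeasurable_locFinMeasure fun t =>
    ((h t).aemeasurable fun n => hN t n).congr (hML t).symm, hML⟩

lemma aemeasurable_integral_locFinMeasure {M : Ω → LocFinMeasure} (hM : AEMeasurable M P)
    (f : C_c(ℝ, ℝ)) : AEMeasurable (fun a => ∫ x, f x ∂(M a).1) P := by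
  have : Continuous fun μ : LocFinMeasure => ∫ x, f x ∂μ.1 :=
    continuous_iff_continuousAt.2 fun μ => tendsto_locFinMeasure_iff.1 tendsto_id f
  exact this.measurable.comp_aemeasurable hM

/-- Convergence on the test family extends to the mass of an interval, if near its end points the
mass of the approximating measures is small in mean, uniformly along the sequence. -/
lemma real_Icc_ae_eq {N : ℕ → Ω → LocFinMeasure} {M : Ω → LocFinMeasure} {A B : ℝ} {L : Ω → ℝ}
    (hNm : ∀ n, AEMeasurable (N n) P) (hM : AEMeasurable M P)
    (h : ∀ t, TendstoInMeasure P (fun n a => ∫ x, testFun t x ∂(N n a).1) atTop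
      fun a => ∫ x, testFun t x ∂(M a).1)
    (hNI : ∀ n, AEMeasurable (fun a => (N n a).1.real (Set.Icc A B)) P)
    (hL : TendstoInMeasure P (fun n a => (N n a).1.real (Set.Icc A B)) atTop L)
    {e : ℕ → ENNReal} (he : Tendsto e atTop (𝓝 0))
    (hNe : ∀ k n, eLpNorm (fun a => ∫ x, trapezoid A B k x ∂(N n a).1 - (N n a).1.real (Set.Icc A B))
      1 P ≤ e k) :
    (fun a => (M a).1.real (Set.Icc A B)) =ᵐ[P] L := by
  obtain ⟨φ, -, hφ⟩ := exists_strictMono_forall_ae_tendsto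
    (Z := fun (t : Option (ℕ × Option ℕ)) n a =>
      t.elim ((N n a).1.real (Set.Icc A B)) fun t => ∫ x, testFun t x ∂(N n a).1)
    (L := fun t a => t.elim (L a) fun t => ∫ x, testFun t x ∂(M a).1)
    fun t => by cases t with
      | none => exact hL
      | some t => exact h t
  have hLm : AEMeasurable L P := hL.aemeasurable hNI
  have h1 : ∀ k, eLpNorm (fun a => ∫ x, trapezoid A B k x ∂(M a).1 - L a) 1 P ≤ e k := fun k => by
    refine Lp.eLpNorm_le_of_ae_tendsto (u := atTop) (f := fun n a =>
      ∫ x, trapezoid A B k x ∂(N (φ n) a).1 - (N (φ n) a).1.real (Set.Icc A B))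
      (.of_forall fun n => hNe k (φ n)) (fun n => ?_) ?_
    · exact ((aemeasurable_integral_locFinMeasure (hNm _) _).sub (hNI _)).aestronglyMeasurable
    · filter_upwards [hφ] with a ha
      exact (tendsto_locFinMeasure_iff.1
        (tendsto_locFinMeasure_iff_testFun.2 fun t => ha (some t)) _).sub (ha none)
  have h2 : ∀ a, Tendsto (fun k => ∫ x, trapezoid A B k x ∂(M a).1) atTop
      (𝓝 ((M a).1.real (Set.Icc A B))) := fun a => by
    rw [← integral_indicator_one measurableSet_Icc]
    refine tendsto_integral_of_dominated_convergence (trapezoid A B 0)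
      (fun k => (integrable_locFinMeasure _ _).aestronglyMeasurable) (integrable_locFinMeasure _ _)
      (fun k => .of_forall fun x => ?_) (.of_forall fun x => ?_)
    · rw [Real.norm_of_nonneg trapezoid_nonneg]
      change max 0 (1 - ((k : ℝ) + 1) * max 0 (max (A - x) (x - B)))
        ≤ max 0 (1 - ((0 : ℕ) + 1) * max 0 (max (A - x) (x - B)))
      gcongr
      simp
    · by_cases hx : x ∈ Set.Icc A B
      · simp [trapezoid_eq_one hx, hx]
      · rw [Set.indicator_of_notMem hx]
        refine tendsto_const_nhds.congr' ?_
        obtain ⟨δ, hδ, hδx⟩ : ∃ δ > 0, x ∉ Set.Icc (A - δ) (B + δ) := by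
          rw [Set.mem_Icc, not_and_or, not_le, not_le] at hx
          rcases hx with h | h
          · exact ⟨(A - x) / 2, by linarith, fun h' => by linarith [h'.1]⟩
          · exact ⟨(x - B) / 2, by linarith, fun h' => by linarith [h'.2]⟩
        filter_upwards [(tendsto_one_div_add_atTop_nhds_zero_nat (𝕜 := ℝ)).eventually
          (Iic_mem_nhds hδ)] with k hk
        refine (trapezoid_eq_zero fun h' => hδx ?_).symm
        exact ⟨by linarith [h'.1, hk], by linarith [h'.2, hk]⟩
  have h3 : eLpNorm (fun a => (M a).1.real (Set.Icc A B) - L a) 1 P ≤ 0 := by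
    refine le_of_forall_pos_le_add fun ε hε => ?_
    rw [zero_add]
    refine Lp.eLpNorm_le_of_ae_tendsto (u := atTop)
      (f := fun k a => ∫ x, trapezoid A B k x ∂(M a).1 - L a) ?_ (fun k => ?_)
      (.of_forall fun a => (h2 a).sub_const _)
    · filter_upwards [he.eventually (Iic_mem_nhds hε)] with k hk
      exact (h1 k).trans hk
    · exact ((aemeasurable_integral_locFinMeasure hM _).sub hLm).aestronglyMeasurable
  have h4 : AEStronglyMeasurable (fun a => (M a).1.real (Set.Icc A B) - L a) P :=
    (aemeasurable_of_tendsto_metrizable_ae atTop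
      (fun k => aemeasurable_integral_locFinMeasure hM (trapezoid A B k))
      (.of_forall h2)).sub hLm |>.aestronglyMeasurable
  filter_upwards [(eLpNorm_eq_zero_iff h4 one_ne_zero).1 (le_zero_iff.1 h3)] with a ha
  exact sub_eq_zero.1 ha

end RandomMeasure

/-! ### The limit measure -/

lemma integral_expMeasure (g : C(ℝ, ℝ)) {A B : ℝ} (hAB : A ≤ B) {f : ℝ → ℝ}
    (hf : ∀ x, x ∉ Set.Icc A B → f x = 0) :
    ∫ x, f x ∂(expMeasure g).1 = ∫ t in A..B, f t * Real.exp (g t) := by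
  have hm : Measurable fun t => ENNReal.ofReal (Real.exp (g t)) := by fun_prop
  rw [expMeasure, integral_withDensity_eq_integral_toReal_smul hm
    (.of_forall fun _ => ENNReal.ofReal_lt_top), intervalIntegral.integral_of_le hAB,
    ← integral_Icc_eq_integral_Ioc, setIntegral_eq_integral_of_forall_compl_eq_zero]
  · refine integral_congr_ae (.of_forall fun t => ?_)
    simp only [smul_eq_mul, ENNReal.toReal_ofReal (Real.exp_pos _).le, mul_comm]
  · intro x hx
    rw [hf x hx, zero_mul]

lemma real_Icc_expMeasure (g : C(ℝ, ℝ)) {A B : ℝ} (hAB : A ≤ B) :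
    (expMeasure g).1.real (Set.Icc A B) = ∫ t in A..B, 1 * Real.exp (g t) := by
  rw [← integral_indicator_one measurableSet_Icc,
    integral_expMeasure g hAB fun x hx => Set.indicator_of_notMem hx _]
  refine intervalIntegral.integral_congr fun t ht => ?_
  rw [Set.uIcc_of_le hAB] at ht
  simp [ht]

section Limit

variable {Ω : Type*} [MeasurableSpace Ω] {P : Measure Ω} {W : (ℝ × ℝ → ℝ) → Ω → ℝ}
  {lam2 T sigma2 : ℝ}

lemma integral_testFun_expMeasure {Ω : Type*} (X : Ω → C(ℝ, ℝ)) (t : ℕ × Option ℕ) :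
    (fun a => ∫ x, testFun t x ∂(expMeasure (X a)).1)
      = pathIntegral (-((t.1 : ℝ) + 1)) (t.1 + 1) (testFun t) X :=
  funext fun a => integral_expMeasure (X a) (by linarith [t.1.cast_nonneg (α := ℝ)])
    fun _ => testFun_eq_zero

lemma real_Icc_expMeasure_eq_pathIntegral {Ω : Type*} (X : Ω → C(ℝ, ℝ)) {A B : ℝ} (hAB : A ≤ B) :
    (fun a => (expMeasure (X a)).1.real (Set.Icc A B)) = pathIntegral A B (fun _ => 1) X :=
  funext fun a => real_Icc_expMeasure (X a) hAB

lemma IsExpField.aestronglyMeasurable_integral_testFun (hW : IsWhiteNoise W P) {g : ℝ → ℝ}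
    {X : Ω → C(ℝ, ℝ)} (hX : IsExpField W P T sigma2 g X) (t : ℕ × Option ℕ) :
    AEStronglyMeasurable (fun a => ∫ x, testFun t x ∂(expMeasure (X a)).1) P := by
  rw [integral_testFun_expMeasure]
  exact hX.aestronglyMeasurable_pathIntegral hW (by linarith [t.1.cast_nonneg (α := ℝ)])
    (testFun t).continuous

lemma IsExpField.aemeasurable_expMeasure (hW : IsWhiteNoise W P) {g : ℝ → ℝ} {X : Ω → C(ℝ, ℝ)}
    (hX : IsExpField W P T sigma2 g X) : AEMeasurable (fun a => expMeasure (X a)) P :=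
  aemeasurable_locFinMeasure fun t => (hX.aestronglyMeasurable_integral_testFun hW t).aemeasurable

variable [IsProbabilityMeasure P]

/-- Uniform control of the mass near the end points of an interval. -/
lemma IsExpField.eLpNorm_trapezoid_sub_le (hW : IsWhiteNoise W P) (hs : 0 ≤ sigma2) {g : ℝ → ℝ}
    {X : Ω → C(ℝ, ℝ)} (hX : IsExpField W P T sigma2 g X) {A B : ℝ} (hAB : A ≤ B) (k : ℕ) :
    eLpNorm (fun a => ∫ x, trapezoid A B k x ∂(expMeasure (X a)).1
      - (expMeasure (X a)).1.real (Set.Icc A B)) 1 P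
      ≤ ENNReal.ofReal (sigma2 * (1 / (k + 1))) + ENNReal.ofReal (sigma2 * (1 / (k + 1))) := by
  set δ : ℝ := 1 / (k + 1)
  have hδ : 0 < δ := by positivity
  have hu : Continuous (trapezoid A B k) := (trapezoid A B k).continuous
  have hu1 : ∀ t, |trapezoid A B k t| ≤ 1 := fun t => by
    rw [abs_of_nonneg trapezoid_nonneg]
    exact trapezoid_le_one
  have e : (fun a => ∫ x, trapezoid A B k x ∂(expMeasure (X a)).1
      - (expMeasure (X a)).1.real (Set.Icc A B))
      = pathIntegral (A - δ) A (trapezoid A B k) X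
        + pathIntegral B (B + δ) (trapezoid A B k) X := by
    ext1 a
    have hi : ∀ c d, IntervalIntegrable (fun t => trapezoid A B k t * Real.exp (X a t)) volume c d :=
      fun c d => (hu.mul (Real.continuous_exp.comp (X a).continuous)).intervalIntegrable c d
    have h1 : ∫ t in A..B, trapezoid A B k t * Real.exp (X a t)
        = (expMeasure (X a)).1.real (Set.Icc A B) := by
      rw [real_Icc_expMeasure _ hAB]
      refine intervalIntegral.integral_congr fun t ht => ?_
      rw [Set.uIcc_of_le hAB] at ht
      simp only [trapezoid_eq_one ht]
    rw [integral_expMeasure (X a) (A := A - δ) (B := B + δ) (by linarith)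
      fun x hx => trapezoid_eq_zero hx, ← h1,
      ← intervalIntegral.integral_add_adjacent_intervals (hi (A - δ) B) (hi B _),
      ← intervalIntegral.integral_add_adjacent_intervals (hi (A - δ) A) (hi A B)]
    simp only [pathIntegral, Pi.add_apply]
    ring
  rw [e]
  refine (eLpNorm_add_le (hX.aestronglyMeasurable_pathIntegral hW (by linarith) hu)
    (hX.aestronglyMeasurable_pathIntegral hW (by linarith) hu) le_rfl).trans (add_le_add ?_ ?_)
  · exact (hX.eLpNorm_one_pathIntegral_le hW hs (by linarith) hu hu1).trans_eq (by ring_nf)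
  · exact (hX.eLpNorm_one_pathIntegral_le hW hs (by linarith) hu hu1).trans_eq (by ring_nf)

/-- The limit random measure: it is the limit in probability, on each test function, of every
regularization. -/
lemma exists_limit_measure (hW : IsWhiteNoise W P) (hlam : 0 < lam2) (hlam' : lam2 < 2)
    (hT : 0 < T) (hs : 0 ≤ sigma2) {Y : ℕ → Ω → C(ℝ, ℝ)}
    (hY : ∀ m : ℕ, IsExpField W P T sigma2 (powKernel lam2 0 (Set.Ioi (2⁻¹ ^ m))) (Y m)) :
    ∃ M : Ω → LocFinMeasure, AEMeasurable M P ∧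
      ∀ {ι : Type} {l : Filter ι} {g : ι → ℝ → ℝ} {X : ι → Ω → C(ℝ, ℝ)},
      IsRegularization W P lam2 T sigma2 (lam2 * (1 + 2 * T)) l g X → ∀ t,
      TendstoInMeasure P (fun i a => ∫ x, testFun t x ∂(expMeasure (X i a)).1) l
        fun a => ∫ x, testFun t x ∂(M a).1 := by
  -- the critical moment is `2 / lam2 > 1`
  obtain ⟨p, hp, hp', hplam⟩ : ∃ p : ℝ, 1 < p ∧ p ≤ 2 ∧ p * lam2 < 2 := by
    have h1 : 1 < min 2 (2 / lam2) := lt_min one_lt_two ((one_lt_div hlam).2 hlam')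
    obtain ⟨p, hp, hp'⟩ := exists_between h1
    exact ⟨p, hp, hp'.le.trans (min_le_left _ _),
      (lt_div_iff₀ hlam).1 (hp'.trans_le (min_le_right _ _))⟩
  have hp0 : ENNReal.ofReal p ≠ 0 := (ENNReal.ofReal_pos.2 (by linarith)).ne'
  have key : ∀ t : ℕ × Option ℕ, ∃ L : Ω → ℝ,
      ∀ {ι : Type} {l : Filter ι} {g : ι → ℝ → ℝ} {X : ι → Ω → C(ℝ, ℝ)},
      IsRegularization W P lam2 T sigma2 (lam2 * (1 + 2 * T)) l g X →
      TendstoInMeasure P (fun i a => ∫ x, testFun t x ∂(expMeasure (X i a)).1) l L := fun t => by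
    obtain ⟨C, hC⟩ := (testFun t).hasCompactSupport.exists_bound_of_continuous (testFun t).continuous
    obtain ⟨L, hLm, hL⟩ := exists_tendsto_eLpNorm_pathIntegral hW hlam.le hT hs hY hp hp' hplam
      (A := -((t.1 : ℝ) + 1)) (B := t.1 + 1) (by linarith [t.1.cast_nonneg (α := ℝ)])
      (testFun t).continuous hC
    refine ⟨L, fun {ι l g X} hX => tendstoInMeasure_of_tendsto_eLpNorm hp0
      (fun i => (hX.isExpField i).aestronglyMeasurable_integral_testFun hW t) hLm ?_⟩
    simp_rw [integral_testFun_expMeasure]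
    exact hL hX
  choose L hL using key
  have hYr := isRegularization_cutoff hlam.le hT (l := atTop) (fun m : ℕ => by positivity)
    (tendsto_pow_atTop_nhds_zero_of_lt_one (by norm_num) (by norm_num)) hY
  obtain ⟨M, hM, hML⟩ := exists_random_locFinMeasure
    (fun t n => ((hY n).aestronglyMeasurable_integral_testFun hW t).aemeasurable)
    fun t => hL t hYr
  exact ⟨M, hM, fun hX t => (hL t hX).congr_right (hML t).symm⟩

/-- In the `L²` regime, the mass of an interval converges in `L²`. -/
lemma tendsto_eLpNorm_real_Icc (hW : IsWhiteNoise W P) (hlam : 0 < lam2) (hlam' : lam2 < 1)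
    (hT : 0 < T) (hs : 0 ≤ sigma2) {Y : ℕ → Ω → C(ℝ, ℝ)}
    (hY : ∀ m : ℕ, IsExpField W P T sigma2 (powKernel lam2 0 (Set.Ioi (2⁻¹ ^ m))) (Y m))
    {M : Ω → LocFinMeasure} (hM : AEMeasurable M P)
    (hYM : ∀ t, TendstoInMeasure P (fun m a => ∫ x, testFun t x ∂(expMeasure (Y m a)).1) atTop
      fun a => ∫ x, testFun t x ∂(M a).1) {A B : ℝ} (hAB : A ≤ B) {ι : Type} {l : Filter ι}
    {g : ι → ℝ → ℝ} {X : ι → Ω → C(ℝ, ℝ)}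
    (hX : IsRegularization W P lam2 T sigma2 (lam2 * (1 + 2 * T)) l g X) :
    Tendsto (fun i => eLpNorm (fun a => (expMeasure (X i a)).1.real (Set.Icc A B)
      - (M a).1.real (Set.Icc A B)) 2 P) l (𝓝 0) := by
  obtain ⟨L, hLm, hL⟩ := exists_tendsto_eLpNorm_pathIntegral hW hlam.le hT hs hY one_lt_two le_rfl
    (by linarith) hAB (continuous_const (y := (1 : ℝ))) (C := 1) (fun _ => by simp)
  simp_rw [ENNReal.ofReal_ofNat] at hL
  have hYr := isRegularization_cutoff hlam.le hT (l := atTop) (fun m : ℕ => by positivity)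
    (tendsto_pow_atTop_nhds_zero_of_lt_one (by norm_num) (by norm_num)) hY
  have hYm : ∀ m, AEStronglyMeasurable
      (fun a => (expMeasure (Y m a)).1.real (Set.Icc A B)) P := fun m => by
    rw [real_Icc_expMeasure_eq_pathIntegral _ hAB]
    exact (hY m).aestronglyMeasurable_pathIntegral hW hAB continuous_const
  have hML : (fun a => (M a).1.real (Set.Icc A B)) =ᵐ[P] L := by
    refine real_Icc_ae_eq (fun m => (hY m).aemeasurable_expMeasure hW) hM hYM
      (fun m => (hYm m).aemeasurable) (tendstoInMeasure_of_tendsto_eLpNorm two_ne_zero hYm hLm ?_)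
      ?_ fun k n => (hY n).eLpNorm_trapezoid_sub_le hW hs hAB k
    · simp_rw [real_Icc_expMeasure_eq_pathIntegral _ hAB]
      exact hL hYr
    · have h1 : Tendsto (fun k : ℕ => ENNReal.ofReal (sigma2 * (1 / (k + 1)))) atTop (𝓝 0) := by
        rw [← ENNReal.ofReal_zero, ← mul_zero sigma2]
        exact ENNReal.tendsto_ofReal (tendsto_one_div_add_atTop_nhds_zero_nat.const_mul sigma2)
      simpa using h1.add h1
  refine (hL hX).congr fun i => eLpNorm_congr_ae ?_
  rw [← real_Icc_expMeasure_eq_pathIntegral _ hAB]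
  filter_upwards [hML] with a ha
  simp only [Pi.sub_apply, ha]

end Limit

end LogSfBM
end

open LogSfBM

theorem proposition2 {Ω : Type*} [MeasurableSpace Ω] (P : Measure Ω) [IsProbabilityMeasure P]
    (W : (ℝ × ℝ → ℝ) → Ω → ℝ) (hW : LogSfBM.IsWhiteNoise W P)
    (lam2 T sigma2 : ℝ) (hlam : 0 < lam2) (hlam' : lam2 < 2) (hT : 0 < T) (hsigma : 0 < sigma2)
    -- the S-fBM processes, with `λ²` and the mean level `σ²` fixed
    (nu m : Set.Ioo (0 : ℝ) (1 / 2) → ℝ)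
    (X : Set.Ioo (0 : ℝ) (1 / 2) → Ω → C(ℝ, ℝ))
    (hX : ∀ H : Set.Ioo (0 : ℝ) (1 / 2), LogSfBM.IsSfBM W P H T (m H) (nu H) (X H))
    (hnu : ∀ H : Set.Ioo (0 : ℝ) (1 / 2), (H : ℝ) * (1 - 2 * H) * nu H ^ 2 = lam2)
    (hm : ∀ H : Set.Ioo (0 : ℝ) (1 / 2),
      Real.exp (m H + Var[fun a => X H a 0; P] / 2) = sigma2)
    -- the cut-off processes whose exponentials define the multifractal random measure
    (mu : Set.Ioi (0 : ℝ) → ℝ)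
    (Y : Set.Ioi (0 : ℝ) → Ω → C(ℝ, ℝ))
    (hY : ∀ ℓ : Set.Ioi (0 : ℝ), LogSfBM.IsMRMCutoff W P lam2 ℓ T (mu ℓ) (Y ℓ))
    (hmu : ∀ ℓ : Set.Ioi (0 : ℝ), Real.exp (mu ℓ + Var[fun a => Y ℓ a 0; P] / 2) = sigma2) :
    Tendsto (fun H => nu H ^ 2) (comap ((↑) : Set.Ioo (0 : ℝ) (1 / 2) → ℝ) (𝓝 0)) atTop ∧
    Tendsto m (comap ((↑) : Set.Ioo (0 : ℝ) (1 / 2) → ℝ) (𝓝 0)) atBot ∧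
    ∃ M : Ω → LogSfBM.LocFinMeasure,
      LogSfBM.WeakLimitAtZero P (fun ℓ a => LogSfBM.expMeasure (Y ℓ a)) M ∧
      LogSfBM.WeakLimitAtZero P (fun H a => LogSfBM.expMeasure (X H a)) M ∧
      (lam2 < 1 → ∀ t : ℝ, 0 ≤ t →
        Tendsto
          (fun H => eLpNorm
            (fun a => (LogSfBM.expMeasure (X H a)).1.real (Set.Icc 0 t) - (M a).1.real (Set.Icc 0 t))
            2 P)
          (comap ((↑) : Set.Ioo (0 : ℝ) (1 / 2) → ℝ) (𝓝 0)) (𝓝 0)) := by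
  have hHl : Tendsto (Subtype.val : Set.Ioo (0 : ℝ) (1 / 2) → ℝ) (comap Subtype.val (𝓝 0))
      (𝓝[>] 0) := tendsto_nhdsWithin_iff.2 ⟨tendsto_comap, .of_forall fun H => H.2.1⟩
  have hinv : Tendsto (fun H : Set.Ioo (0 : ℝ) (1 / 2) => (H : ℝ)⁻¹) (comap Subtype.val (𝓝 0))
      atTop := tendsto_inv_nhdsGT_zero.comp hHl
  have hXc : ∀ H : Set.Ioo (0 : ℝ) (1 / 2), IsConeProcess W P lam2 H 0 T (m H) (X H) := fun H => by
    have := hX H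
    rwa [IsSfBM, hnu H] at this
  have hXg : ∀ H : Set.Ioo (0 : ℝ) (1 / 2),
      MemLp (powKernel lam2 H (Set.Ioi 0)) 2 (scaleMeasure T) := fun H =>
    memLp_powKernel hlam.le hT measurableSet_Ioi subset_rfl
      (integrableOn_covDensity_zero hlam.le hT (by linarith [H.2.1]) (by linarith [H.2.2]))
  have hYg : ∀ ℓ : Set.Ioi (0 : ℝ),
      MemLp (powKernel lam2 0 (Set.Ioi (ℓ : ℝ))) 2 (scaleMeasure T) := fun ℓ =>
    memLp_powKernel hlam.le hT measurableSet_Ioi (Set.Ioi_subset_Ioi (le_of_lt ℓ.2))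
      (integrableOn_covDensity_of_pos hlam.le hT (by norm_num) (by norm_num) ℓ.2)
  have hXe := fun H => (hXc H).isExpField hW le_rfl (hXg H) (hm H)
  have hYe := fun ℓ : Set.Ioi (0 : ℝ) =>
    IsConeProcess.isExpField hW (hY ℓ) (le_of_lt ℓ.2) (hYg ℓ) (hmu ℓ)
  refine ⟨?_, ?_, ?_⟩
  · refine tendsto_atTop_mono (fun H => ?_) (hinv.const_mul_atTop hlam)
    have h1 := H.2.1
    have h2 := H.2.2
    rw [← div_eq_mul_inv, div_le_iff₀ h1, ← hnu H]
    nlinarith [mul_nonneg (mul_nonneg h1.le h1.le) (sq_nonneg (nu H))]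
  · -- the variance is at least `lam2 * min 1 T / (2 * H)`
    have hc : 0 < lam2 * min 1 T / 4 := by positivity
    refine tendsto_atBot_mono (fun H => ?_) (tendsto_atBot_add_const_left _ (Real.log sigma2)
      (tendsto_neg_atTop_atBot.comp (hinv.const_mul_atTop hc)))
    have h1 := H.2.1
    have h2 := (hXc H).variance_eq hW le_rfl (hXg H)
    rw [integral_powKernel_sq hlam.le hT _ measurableSet_Ioi subset_rfl] at h2
    have h3 := le_integral_covDensity hlam.le hT (s := 2 * H) (by linarith) (by linarith [H.2.2])
    have h4 : m H + Var[fun a => X H a 0; P] / 2 = Real.log sigma2 := by rw [← hm H, Real.log_exp]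
    have h5 : lam2 * min 1 T / (2 * H) / 2 = lam2 * min 1 T / 4 * (H : ℝ)⁻¹ := by
      field_simp
      norm_num
    simp only [Function.comp_apply]
    linarith
  · have h2 : ∀ n : ℕ, (2⁻¹ : ℝ) ^ n ∈ Set.Ioi 0 := fun n => Set.mem_Ioi.2 (by positivity)
    set Z : ℕ → Ω → C(ℝ, ℝ) := fun n => Y ⟨2⁻¹ ^ n, h2 n⟩
    have hZ : ∀ n, IsExpField W P T sigma2 (powKernel lam2 0 (Set.Ioi (2⁻¹ ^ n))) (Z n) :=
      fun n => hYe ⟨2⁻¹ ^ n, h2 n⟩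
    have hZr := isRegularization_cutoff hlam.le hT (l := atTop) h2
      (tendsto_pow_atTop_nhds_zero_of_lt_one (by norm_num) (by norm_num)) hZ
    have hXr := isRegularization_sfbm hlam.le hT hHl hXe
    have hYr := isRegularization_cutoff hlam.le hT (fun ℓ : Set.Ioi (0 : ℝ) => ℓ.2)
      tendsto_comap hYe
    obtain ⟨M, hM, hMX⟩ := exists_limit_measure hW hlam hlam' hT hsigma.le hZ
    refine ⟨M, ?_, ?_, fun hlam1 t ht => ?_⟩
    · exact tendstoInDistribution_of_testFun (fun ℓ => (hYe ℓ).aemeasurable_expMeasure hW) hM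
        (hMX hYr)
    · exact tendstoInDistribution_of_testFun (fun H => (hXe H).aemeasurable_expMeasure hW) hM
        (hMX hXr)
    · exact tendsto_eLpNorm_real_Icc hW hlam hlam1 hT hsigma.le hZ hM (hMX hZr) ht hXr
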